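/- Throughout, a variety is an integral separated scheme of finite type over $\mathbb{C}$. A symplectic form on a smooth variety is a closed algebraic $2$-form that is nondegenerate at every point. A resolution of a variety $X$ is a proper birational morphism $\pi\colon\widetilde X\to X$ from a smooth variety $\widetilde X$. Given a symplectic form $\sigma\in\Gamma(X_{reg},\Omega^2_{X_{reg}})$ on the regular part $X_{reg}$ of $X$, a resolution $\pi$ is called symplectic if there is a symplectic form $\widetilde\sigma$ on $\widetilde X$ whose restriction to $\pi^{-1}(X_{reg})$ is $\pi^*\sigma$. The morphism $\pi$ is called semismall if for every integer $k\ge 0$ the closed set $\{x\in X : \dim \pi^{-1}(x)\ge k\}$ has codimension at least $2k$ in $X$ (the empty set has codimension $\infty$). Proposition. Let $X$ be a variety with a symplectic form $\sigma$ on $X_{reg}$, and let $\pi\colon\widetilde X\to X$ be a semismall resolution. Suppose that there is a closed subset $F$ of $X$ of codimension $\ge 4$ such that the restriction $\widetilde X\setminus\pi^{-1}(F)\to X\setminus F$ is a symplectic resolution of $X\setminus F$ with respect to the restriction of $\sigma$ to $(X\setminus F)_{reg} = X_{reg}\setminus F$. Then $\pi$ is a symplectic resolution of $X$. -/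

import Mathlib

open CategoryTheory AlgebraicGeometry TopologicalSpace Opposite
open scoped KaehlerDifferential

noncomputable section

namespace SymplRes

/-! ### Kähler `p`-forms of commutative `ℂ`-algebras -/

/-- The module `Λ^p_A Ω_{A/ℂ}` of Kähler `p`-forms of a commutative `ℂ`-algebra `A`. -/
abbrev AlgForm (A : Type) [CommRing A] [Algebra ℂ A] (p : ℕ) : Type :=
  ⋀[A]^p Ω[A⁄ℂ]

/-- Pullback of `p`-forms along a homomorphism of `ℂ`-algebras `φ : A → B`: the additive map
`Λ^p_A Ω_{A/ℂ} → Λ^p_B Ω_{B/ℂ}` with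
`a • da₁ ∧ ⋯ ∧ da_p ↦ φ a • d(φ a₁) ∧ ⋯ ∧ d(φ a_p)`. -/
def AlgForm.map {A B : Type} [CommRing A] [CommRing B] [Algebra ℂ A] [Algebra ℂ B]
    (φ : A →ₐ[ℂ] B) (p : ℕ) : AlgForm A p →+ AlgForm B p :=
  letI : Algebra A B := φ.toRingHom.toAlgebra
  haveI : IsScalarTower ℂ A B := IsScalarTower.of_algebraMap_eq' φ.comp_algebraMap.symm
  (exteriorPower.alternatingMapLinearEquiv
    { ((exteriorPower.ιMulti B p (M := Ω[B⁄ℂ])).toMultilinearMap.restrictScalars A).compLinearMap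
        (fun _ => KaehlerDifferential.map ℂ ℂ A B) with
      map_eq_zero_of_eq' := fun v _ _ h hij =>
        (exteriorPower.ιMulti B p (M := Ω[B⁄ℂ])).map_eq_zero_of_eq
          (fun k => KaehlerDifferential.map ℂ ℂ A B (v k))
          (congrArg (KaehlerDifferential.map ℂ ℂ A B) h) hij }).toAddMonoidHom

/-- Evaluation of a `p`-form on `p` linear functionals `L₁, …, L_p : Ω_{A/ℂ} → K` with values
in a commutative `A`-algebra `K`:
`α₁ ∧ ⋯ ∧ α_p ↦ det (L_j (α_i))`.
For `K = A` these functionals are the vector fields on `Spec A`; for `K` the residue field at a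
point of `Spec A` they are the tangent vectors at this point. -/
def AlgForm.eval {A : Type} [CommRing A] [Algebra ℂ A] {K : Type} [CommRing K] [Algebra A K]
    {p : ℕ} (L : Fin p → (Ω[A⁄ℂ] →ₗ[A] K)) : AlgForm A p →ₗ[A] K :=
  exteriorPower.alternatingMapLinearEquiv
    { ((Matrix.detRowAlternating (n := Fin p) (R := K)).toMultilinearMap.restrictScalars
        A).compLinearMap (fun _ => LinearMap.pi L) with
      map_eq_zero_of_eq' := fun v _ _ h hij =>
        (Matrix.detRowAlternating (n := Fin p) (R := K)).map_eq_zero_of_eq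
          (fun k => LinearMap.pi L (v k)) (congrArg (LinearMap.pi L) h) hij }

/-- The function `ω(D₁, D₂)` for a `2`-form `ω` and vector fields `D₁`, `D₂` (derivations). -/
def AlgForm.evalDer {A : Type} [CommRing A] [Algebra ℂ A] (ω : AlgForm A 2)
    (D₁ D₂ : Derivation ℂ A A) : A :=
  AlgForm.eval ![D₁.liftKaehlerDifferential, D₂.liftKaehlerDifferential] ω

/-- `dω = 0` for a `2`-form on a smooth affine variety, where `dω` is given by the invariant
formula for the exterior derivative:
`dω(D₁, D₂, D₃) = D₁ ω(D₂, D₃) - D₂ ω(D₁, D₃) + D₃ ω(D₁, D₂)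
  - ω([D₁, D₂], D₃) + ω([D₁, D₃], D₂) - ω([D₂, D₃], D₁)`. -/
def AlgForm.IsClosed {A : Type} [CommRing A] [Algebra ℂ A] (ω : AlgForm A 2) : Prop :=
  ∀ D₁ D₂ D₃ : Derivation ℂ A A,
    D₁ (ω.evalDer D₂ D₃) - D₂ (ω.evalDer D₁ D₃) + D₃ (ω.evalDer D₁ D₂)
      - ω.evalDer ⁅D₁, D₂⁆ D₃ + ω.evalDer ⁅D₁, D₃⁆ D₂ - ω.evalDer ⁅D₂, D₃⁆ D₁ = 0

/-- Nondegeneracy of a `2`-form at the point of `Spec A` given by a homomorphism from `A` to a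
field `K`: no nonzero tangent vector `u` is orthogonal to all tangent vectors. -/
def AlgForm.NondegenerateAt {A : Type} [CommRing A] [Algebra ℂ A] {K : Type} [Field K]
    (e : A →+* K) (ω : AlgForm A 2) : Prop :=
  letI : Algebra A K := e.toAlgebra
  ∀ u : Ω[A⁄ℂ] →ₗ[A] K, (∀ v : Ω[A⁄ℂ] →ₗ[A] K, AlgForm.eval ![u, v] ω = 0) → u = 0

/-! ### Differential forms on schemes over `ℂ` -/

theorem le_preimage_top {X Y : Scheme.{0}} (f : X ⟶ Y) (V : X.Opens) : V ≤ f ⁻¹ᵁ ⊤ :=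
  fun _ _ => trivial

/-- The `ℂ`-algebra `Γ(X, V)` of a scheme `f : X ⟶ Spec ℂ`. -/
def Sections {X : Scheme.{0}} (_f : X ⟶ Spec (.of ℂ)) (V : X.Opens) : Type := Γ(X, V)

instance {X : Scheme.{0}} (f : X ⟶ Spec (.of ℂ)) (V : X.Opens) : CommRing (Sections f V) :=
  inferInstanceAs (CommRing Γ(X, V))

instance {X : Scheme.{0}} (f : X ⟶ Spec (.of ℂ)) (V : X.Opens) : Algebra ℂ (Sections f V) :=
  RingHom.toAlgebra
    (((Scheme.ΓSpecIso (.of ℂ)).inv ≫ f.appLE ⊤ V (le_preimage_top f _)).hom : ℂ →+* Γ(X, V))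

/-- Restriction of functions `Γ(X, V) → Γ(X, W)` for `W ⊆ V`. -/
def resHom {X : Scheme.{0}} (f : X ⟶ Spec (.of ℂ)) {V W : X.Opens} (h : W ≤ V) :
    Sections f V →ₐ[ℂ] Sections f W where
  toRingHom := (X.presheaf.map (homOfLE h).op).hom
  commutes' z := by
    change (((Scheme.ΓSpecIso (.of ℂ)).inv ≫ f.appLE ⊤ V (le_preimage_top f _)) ≫
      X.presheaf.map (homOfLE h).op).hom z = ((Scheme.ΓSpecIso (.of ℂ)).inv ≫ f.appLE ⊤ W (le_preimage_top f _)).hom z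
    rw [Category.assoc, Scheme.Hom.appLE_map]

/-- Pullback of functions `Γ(X, V) → Γ(Y, W)` along `π : Y ⟶ X`, for `W ⊆ π⁻¹(V)`. -/
def pullHom {X Y : Scheme.{0}} (f : X ⟶ Spec (.of ℂ)) (π : Y ⟶ X) {V : X.Opens} {W : Y.Opens}
    (h : W ≤ π ⁻¹ᵁ V) : Sections f V →ₐ[ℂ] Sections (π ≫ f) W where
  toRingHom := (π.appLE V W h).hom
  commutes' z := by
    change (((Scheme.ΓSpecIso (.of ℂ)).inv ≫ f.appLE ⊤ V (le_preimage_top f _)) ≫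
      π.appLE V W h).hom z = ((Scheme.ΓSpecIso (.of ℂ)).inv ≫ (π ≫ f).appLE ⊤ W (le_preimage_top _ _)).hom z
    rw [Category.assoc, Scheme.Hom.appLE_comp_appLE]

/-- A section of the quasi-coherent sheaf `Ω^p_{X/ℂ}` over an open subset `U` of `X`: a family of
`p`-forms on the affine open subsets of `U` which is compatible with restriction. -/
structure DiffForm {X : Scheme.{0}} (f : X ⟶ Spec (.of ℂ)) (U : X.Opens) (p : ℕ) where
  /-- the form on an affine open subset of `U` -/
  on : ∀ V : X.Opens, IsAffineOpen V → V ≤ U → AlgForm (Sections f V) p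
  /-- compatibility with restriction -/
  res : ∀ (V W : X.Opens) (hV : IsAffineOpen V) (hW : IsAffineOpen W) (hVU : V ≤ U) (hWV : W ≤ V),
    AlgForm.map (resHom f hWV) p (on V hV hVU) = on W hW (hWV.trans hVU)

/-- A symplectic form on a smooth open subset `U` of `X`: a closed `2`-form which is nondegenerate
at every point of `U`. -/
structure DiffForm.IsSymplectic {X : Scheme.{0}} {f : X ⟶ Spec (.of ℂ)} {U : X.Opens}
    (σ : DiffForm f U 2) : Prop where
  closed : ∀ (V : X.Opens) (hV : IsAffineOpen V) (hVU : V ≤ U), (σ.on V hV hVU).IsClosed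
  nondegenerate : ∀ (V : X.Opens) (hV : IsAffineOpen V) (hVU : V ≤ U) (x : X) (hx : x ∈ V),
    AlgForm.NondegenerateAt (A := Sections f V) (X.evaluation V x hx).hom (σ.on V hV hVU)

/-! ### Varieties, resolutions, codimension, semismallness -/

/-- A complex algebraic variety: an integral separated scheme of finite type over `ℂ`. -/
structure IsVariety {X : Scheme.{0}} (f : X ⟶ Spec (.of ℂ)) : Prop where
  isIntegral : IsIntegral X
  isSeparated : IsSeparated f
  locallyOfFiniteType : LocallyOfFiniteType f
  quasiCompact : QuasiCompact f

/-- The regular part `X_reg`: the largest open subset of `X` all of whose points are regular.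
(For a variety the set of all regular points is itself open.) -/
def regularLocus (X : Scheme.{0}) : X.Opens :=
  ⟨interior {x : X | IsRegularLocalRing (X.presheaf.stalk x)}, isOpen_interior⟩

/-- `π : Y ⟶ X` is a resolution of singularities: a proper birational morphism from a smooth
variety. -/
structure IsResolution {X Y : Scheme.{0}} (f : X ⟶ Spec (.of ℂ)) (π : Y ⟶ X) : Prop where
  isVariety : IsVariety (π ≫ f)
  smooth : Smooth (π ≫ f)
  isProper : IsProper π
  birational : ∃ U : X.Opens, Dense (U : Set X) ∧ Dense ((π ⁻¹ᵁ U : Y.Opens) : Set Y) ∧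
    IsIso (π ∣_ U)

/-- The codimension of a closed subset `Z` of `X`: the infimum over the points `x` of `Z` of the
codimension of the closure of `x` (the coheight of `x` in the specialization order). It is `⊤` for
the empty set. -/
def codim {X : Scheme.{0}} (Z : Set X) : ℕ∞ := ⨅ x ∈ Z, Order.coheight x

/-- `π : Y ⟶ X` is semismall: for every `k` the locus of points of `X` over which the fibre has
dimension at least `k` has codimension at least `2 * k`. -/
def IsSemismall {X Y : Scheme.{0}} (π : Y ⟶ X) : Prop :=
  ∀ k : ℕ, (2 * k : ℕ∞) ≤ codim {x : X | (k : WithBot ℕ∞) ≤ topologicalKrullDim (π.fiber x)}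

/-! ### Symplectic resolutions -/

/-- The form `σ` on the regular part of `X`, pulled back along `π : Y ⟶ X` and considered over the
open subset `U` of `X`, extends to the form `τ` on `π⁻¹(U)`: the restriction of `τ` to
`π⁻¹(U ∩ X_reg)` is `π^* σ`. -/
def IsExtension {X Y : Scheme.{0}} {f : X ⟶ Spec (.of ℂ)} {π : Y ⟶ X}
    (σ : DiffForm f (regularLocus X) 2) (U : X.Opens) (τ : DiffForm (π ≫ f) (π ⁻¹ᵁ U) 2) : Prop :=
  ∀ (V : X.Opens) (hV : IsAffineOpen V) (hVr : V ≤ regularLocus X) (hVU : V ≤ U)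
    (W : Y.Opens) (hW : IsAffineOpen W) (hWV : W ≤ π ⁻¹ᵁ V),
    τ.on W hW (hWV.trans (π.preimage_mono hVU)) =
      AlgForm.map (pullHom f π hWV) 2 (σ.on V hV hVr)

/-- Over the open subset `U` of `X`, the form `σ` on the regular part of `X` extends to a symplectic
form on `π⁻¹(U)`. -/
def ExtendsSymplecticallyOver {X Y : Scheme.{0}} (f : X ⟶ Spec (.of ℂ)) (π : Y ⟶ X)
    (σ : DiffForm f (regularLocus X) 2) (U : X.Opens) : Prop :=
  ∃ τ : DiffForm (π ≫ f) (π ⁻¹ᵁ U) 2, τ.IsSymplectic ∧ IsExtension σ U τ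

/-- `π : Y ⟶ X` is a symplectic resolution of `(X, σ)`: a resolution such that `σ` extends to a
symplectic form on all of `Y`. -/
def IsSymplecticResolution {X Y : Scheme.{0}} (f : X ⟶ Spec (.of ℂ)) (π : Y ⟶ X)
    (σ : DiffForm f (regularLocus X) 2) : Prop :=
  IsResolution f π ∧ ExtendsSymplecticallyOver f π σ ⊤

/-- The restriction `π⁻¹(U) ⟶ U` of `π : Y ⟶ X` is a symplectic resolution of `(U, σ|_U)`. -/
def RestrictsToSymplecticResolution {X Y : Scheme.{0}} (f : X ⟶ Spec (.of ℂ)) (π : Y ⟶ X)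
    (σ : DiffForm f (regularLocus X) 2) (U : X.Opens) : Prop :=
  IsResolution (U.ι ≫ f) (π ∣_ U) ∧ ExtendsSymplecticallyOver f π σ U

end SymplRes

end

/-! A symplectic form on `π⁻¹(X \ F)` extends to `Y` as soon as `π⁻¹(F)` contains no point of
codimension at most one, and semismallness guarantees this.

Codimension count: let `y` have codimension at most one in `Y`, with image `x`. Comparing
transcendence degrees of `Y`, `X` and the closures of `y` and `x` shows that the fibre over `x` has
dimension at least some `d` with `codim x ≤ d + 1`
(`IsResolution.exists_coheight_le_topologicalKrullDim_fiber_add_one`). Semismallness gives `2d ≤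
codim x`, hence `d ≤ 1` and `codim x ≤ 2`, so `x` is not in `F`.

Extension: a smooth algebra is normal, so its functions extend over closed subsets of codimension at
least two. Applied to the coefficients of a `2`-form in a dual basis of the projective module of
differentials, this extends the form (`exists_diffForm_of_coheight_le_one`).

Properties of the extension (`isSymplectic_of_coheight_le_one`,
`isExtension_top_of_coheight_le_one`): closedness and agreement with the pullback of `σ` are
identities between sections of torsion-free modules, so they can be checked on a nonempty open
subset. Nondegeneracy holds because the determinant of the form in a local basis lies in no prime of
height at most one and is therefore a unit, by Krull's principal ideal theorem. -/

/-! ### Transcendence degree and height in algebras of finite type -/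

open Cardinal in
/-- The transcendence degree of a domain of finite type drops modulo a nonzero prime. -/
theorem Ideal.trdeg_quotient_lt {k C : Type} [Field k] [CommRing C] [IsDomain C] [Algebra k C]
    [Algebra.FiniteType k C] (P : Ideal C) [P.IsPrime] (hP : P ≠ ⊥) :
    Algebra.trdeg k (C ⧸ P) < Algebra.trdeg k C := by
  have : FaithfulSMul k (C ⧸ P) := (faithfulSMul_iff_algebraMap_injective k (C ⧸ P)).mpr
    (algebraMap k (C ⧸ P)).injective
  by_contra! hle
  obtain ⟨s, hs⟩ := exists_isTranscendenceBasis k (C ⧸ P)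
  let y : s → C := fun i => (Ideal.Quotient.mk_surjective i.1).choose
  have hy : (Ideal.Quotient.mkₐ k P) ∘ y = ((↑) : s → C ⧸ P) :=
    funext fun i => (Ideal.Quotient.mk_surjective i.1).choose_spec
  have hyi : AlgebraicIndependent k y :=
    AlgebraicIndependent.of_comp (Ideal.Quotient.mkₐ k P) (by rw [hy]; exact hs.1)
  -- If the degree did not drop, lifting a transcendence basis of the quotient would give one of
  -- `C`. A nonzero element of `P` would then divide a nonzero polynomial in the lifts, which
  -- becomes a relation modulo `P`.
  have hyt : IsTranscendenceBasis k y :=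
    hyi.isTranscendenceBasis_of_trdeg_le (trdeg_lt_aleph0_of_finiteType)
      (hle.trans hs.cardinalMk_eq_trdeg.ge)
  have := hyt.isAlgebraic
  obtain ⟨c, hc, hc0⟩ := Submodule.exists_mem_ne_zero_of_ne_bot hP
  obtain ⟨r, hr0, hr⟩ := (Algebra.IsAlgebraic.isAlgebraic
    (R := Algebra.adjoin k (Set.range y)) c).exists_nonzero_dvd (mem_nonZeroDivisors_of_ne_zero hc0)
  have hrP : (r : C) ∈ P := P.mem_of_dvd hr hc
  obtain ⟨p, hp⟩ : ∃ p, MvPolynomial.aeval y p = (r : C) := by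
    have hr' := (Algebra.adjoin_range_eq_range_aeval k y).le r.2
    exact hr'
  have h0 : MvPolynomial.aeval ((↑) : s → C ⧸ P) p = 0 := by
    rw [← hy]
    change MvPolynomial.aeval (fun i => Ideal.Quotient.mkₐ k P (y i)) p = 0
    rw [← MvPolynomial.comp_aeval_apply, hp]
    exact Ideal.Quotient.eq_zero_iff_mem.mpr hrP
  have hp0 : p = 0 := hs.1 (by rw [h0, map_zero])
  apply hr0
  ext
  rw [← hp, hp0]
  simp

/-- The transcendence degree of an algebra as a natural number. -/
noncomputable def Algebra.natTrdeg (k C : Type) [CommRing k] [CommRing C] [Algebra k C] : ℕ :=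
  (Algebra.trdeg k C).toNat

theorem Algebra.natTrdeg_le_of_injective {k A B : Type} [Field k] [CommRing A] [CommRing B]
    [Algebra k A] [Algebra k B] [Algebra.FiniteType k B]
    (f : A →ₐ[k] B) (hf : Function.Injective f) :
    Algebra.natTrdeg k A ≤ Algebra.natTrdeg k B :=
  Cardinal.toNat_le_toNat (trdeg_le_of_injective f hf) trdeg_lt_aleph0_of_finiteType

theorem Ideal.natTrdeg_quotient_lt {k C : Type} [Field k] [CommRing C] [IsDomain C] [Algebra k C]
    [Algebra.FiniteType k C] (P : Ideal C) [P.IsPrime] (hP : P ≠ ⊥) :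
    Algebra.natTrdeg k (C ⧸ P) < Algebra.natTrdeg k C :=
  Cardinal.toNat_lt_toNat (P.trdeg_quotient_lt hP) trdeg_lt_aleph0_of_finiteType

theorem Ideal.natTrdeg_quotient_lt_of_lt {k C : Type} [Field k] [CommRing C] [Algebra k C]
    [Algebra.FiniteType k C] (P Q : Ideal C) [P.IsPrime] [Q.IsPrime] (h : P < Q) :
    Algebra.natTrdeg k (C ⧸ Q) < Algebra.natTrdeg k (C ⧸ P) := by
  have : (Q.map (Ideal.Quotient.mk P)).IsPrime :=
    Ideal.map_isPrime_of_surjective Ideal.Quotient.mk_surjective (by simpa using h.le)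
  have hne : Q.map (Ideal.Quotient.mk P) ≠ ⊥ := by
    intro h0
    rw [Ideal.map_eq_bot_iff_le_ker, Ideal.mk_ker] at h0
    exact h.not_ge h0
  have key := Ideal.natTrdeg_quotient_lt (k := k) _ hne
  have e : ((C ⧸ P) ⧸ Q.map (Ideal.Quotient.mk P)) ≃ₐ[k] C ⧸ Q :=
    (DoubleQuot.quotQuotEquivQuotOfLEₐ k h.le)
  rwa [Algebra.natTrdeg, e.trdeg_eq] at key

/-- The transcendence degree of the residue domain drops strictly along chains of primes, so its
defect is a strictly monotone function to `ℕ` and bounds the height. -/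
theorem Ideal.height_add_natTrdeg_le {k A : Type} [Field k] [CommRing A] [IsDomain A] [Algebra k A]
    [Algebra.FiniteType k A] (p : Ideal A) [p.IsPrime] :
    p.height + Algebra.natTrdeg k (A ⧸ p) ≤ Algebra.natTrdeg k A := by
  have hle : ∀ q : Ideal A, Algebra.natTrdeg k (A ⧸ q) ≤ Algebra.natTrdeg k A := fun q =>
    Cardinal.toNat_le_toNat (trdeg_le_of_surjective (Ideal.Quotient.mkₐ k q)
      (Ideal.Quotient.mkₐ_surjective k q)) trdeg_lt_aleph0_of_finiteType
  have hmono : StrictMono (fun q : PrimeSpectrum A =>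
      Algebra.natTrdeg k A - Algebra.natTrdeg k (A ⧸ q.asIdeal)) := by
    intro q r hqr
    have := Ideal.natTrdeg_quotient_lt_of_lt (k := k) q.asIdeal r.asIdeal hqr
    have := hle q.asIdeal
    have := hle r.asIdeal
    dsimp only
    omega
  have := Order.height_le_height_apply_of_strictMono _ hmono ⟨p, inferInstance⟩
  rw [← PrimeSpectrum.height_eq_orderHeight, Order.height_nat] at this
  refine (add_le_add_left this _).trans ?_
  dsimp only
  rw [← Nat.cast_add, Nat.sub_add_cancel (hle p)]

theorem Algebra.natTrdeg_eq_of_isIntegral {k A B : Type} [Field k] [CommRing A] [CommRing B]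
    [IsDomain A] [IsDomain B] [Algebra k A] [Algebra k B] [Algebra A B] [IsScalarTower k A B]
    [Algebra.IsIntegral A B] [FaithfulSMul A B] :
    Algebra.natTrdeg k B = Algebra.natTrdeg k A := by
  have : Algebra.IsAlgebraic A B := Algebra.IsIntegral.isAlgebraic
  have h := trdeg_add_eq k A (A := B)
  rw [trdeg_eq_zero (R := A), add_zero] at h
  rw [natTrdeg, natTrdeg, h]

/-- If `f` involves the variable `X i`, so does every nonzero multiple of `f`. Hence the other `n -
1` variables stay algebraically independent modulo `f`. -/
theorem MvPolynomial.natTrdeg_le_natTrdeg_quotient_span_add_one {k : Type} [Field k] {n : ℕ}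
    (f : MvPolynomial (Fin n) k) (hf : Prime f) :
    n ≤ Algebra.natTrdeg k (MvPolynomial (Fin n) k ⧸ Ideal.span {f}) + 1 := by
  obtain ⟨i, hi⟩ : ∃ i, i ∈ f.vars := by
    by_contra! h
    have : f.vars = ∅ := Finset.eq_empty_of_forall_notMem h
    obtain ⟨c, rfl⟩ : ∃ c, f = C c := ⟨_, vars_eq_empty_iff_eq_C.mp this⟩
    have hc : c ≠ 0 := by rintro rfl; exact hf.ne_zero C_0
    exact hf.not_isUnit ((isUnit_iff_ne_zero.mpr hc).map C)
  have hind : AlgebraicIndependent k (fun j : {j : Fin n // j ≠ i} =>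
      Ideal.Quotient.mkₐ k (Ideal.span {f}) (X (j : Fin n))) := by
    rw [AlgebraicIndependent, injective_iff_map_eq_zero]
    intro p hp
    have h1 : aeval (fun j : {j : Fin n // j ≠ i} =>
        Ideal.Quotient.mkₐ k (Ideal.span {f}) (X (j : Fin n))) p =
        Ideal.Quotient.mkₐ k (Ideal.span {f}) (rename (↑) p) := by
      rw [← AlgHom.comp_apply]
      congr 1
      ext j
      simp
    rw [h1] at hp
    have hmem : f ∣ rename ((↑) : {j : Fin n // j ≠ i} → Fin n) p :=
      Ideal.mem_span_singleton.mp (Ideal.Quotient.eq_zero_iff_mem.mp hp)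
    by_contra hp0
    obtain ⟨g, hg⟩ := hmem
    have hr0 : rename ((↑) : {j : Fin n // j ≠ i} → Fin n) p ≠ 0 := by
      rwa [Ne, rename_eq_zero_iff_of_injective _ Subtype.val_injective]
    have hg0 : g ≠ 0 := by rintro rfl; exact hr0 (by rw [hg, mul_zero])
    have hd := degreeOf_mul_eq (n := i) hf.ne_zero hg0
    have hz : degreeOf i (rename ((↑) : {j : Fin n // j ≠ i} → Fin n) p) = 0 := by
      by_contra hmem
      rw [← Ne, ← mem_vars_iff_degreeOf_ne_zero] at hmem
      obtain ⟨j, -, hj⟩ := mem_vars_rename _ _ hmem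
      exact j.2 hj
    rw [← hg, hz] at hd
    have := mem_vars_iff_degreeOf_ne_zero.mp hi
    omega
  have := hind.cardinalMk_le_trdeg
  have h2 := Cardinal.toNat_le_toNat this trdeg_lt_aleph0_of_finiteType
  simp only [Cardinal.mk_fintype, Cardinal.toNat_natCast, Fintype.card_subtype_compl, Fintype.card_fin, Fintype.card_unique] at h2
  rw [Algebra.natTrdeg]
  have : 0 < n := i.pos
  simp at h2
  omega

/-- Noether normalization reduces this to a polynomial ring: by going down, the contraction of `q`
still has height at most one, so by unique factorization it is zero or generated by a prime element.
-/
theorem Ideal.natTrdeg_le_natTrdeg_quotient_add_one {k B : Type} [Field k] [CommRing B] [IsDomain B]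
    [Algebra k B] [Algebra.FiniteType k B] (q : Ideal B) [q.IsPrime] (hq : q.height ≤ 1) :
    Algebra.natTrdeg k B ≤ Algebra.natTrdeg k (B ⧸ q) + 1 := by
  obtain ⟨n, g, hg, hgi⟩ := exists_integral_inj_algHom_of_fg k B
  algebraize [g.toRingHom]
  have : IsScalarTower k (MvPolynomial (Fin n) k) B := .of_algebraMap_eq' g.comp_algebraMap.symm
  have : FaithfulSMul (MvPolynomial (Fin n) k) B := (faithfulSMul_iff_algebraMap_injective _ _).mpr hg
  have : Algebra.IsIntegral (MvPolynomial (Fin n) k) B := ⟨hgi⟩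
  have : IsNoetherianRing B := Algebra.FiniteType.isNoetherianRing k B
  have hn : Algebra.natTrdeg k (MvPolynomial (Fin n) k) = n := by simp [Algebra.natTrdeg]
  rw [Algebra.natTrdeg_eq_of_isIntegral (A := MvPolynomial (Fin n) k), hn]
  set q' := q.under (MvPolynomial (Fin n) k) with hq'
  have hq'1 : q'.height ≤ 1 := by
    rw [Ideal.height_eq_height_add_of_liesOver_of_hasGoingDown q' q] at hq
    exact le_self_add.trans hq
  have hle : Algebra.natTrdeg k (MvPolynomial (Fin n) k ⧸ q') ≤ Algebra.natTrdeg k (B ⧸ q) :=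
    Algebra.natTrdeg_le_of_injective
      (Ideal.quotientMapₐ q (IsScalarTower.toAlgHom k (MvPolynomial (Fin n) k) B) le_rfl)
      (Ideal.quotientMap_injective (I := q) (f := algebraMap (MvPolynomial (Fin n) k) B))
  by_cases h0 : q' = ⊥
  · have := Algebra.natTrdeg_le_of_injective (Ideal.Quotient.mkₐ k q')
      ((RingHom.injective_iff_ker_eq_bot _).mpr (Ideal.mk_ker.trans h0))
    rw [hn] at this
    omega
  · obtain ⟨f, hf, hfp⟩ := Ideal.IsPrime.exists_mem_prime_of_ne_bot (I := q') inferInstance h0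
    have : (Ideal.span {f}).IsPrime := (Ideal.span_singleton_prime hfp.ne_zero).mpr hfp
    have hfq : Ideal.span {f} = q' := by
      refine ((Ideal.span_singleton_le_iff_mem _).mpr hf).eq_of_not_lt fun hlt => ?_
      have h1 := Ideal.height_strict_mono_of_isPrime_of_isPrime hlt
      have h2 := Ideal.one_le_height_span_singleton_of_mem_nonZeroDivisors
        (mem_nonZeroDivisors_of_ne_zero hfp.ne_zero)
      exact absurd (h2.trans_lt h1) hq'1.not_gt
    have := MvPolynomial.natTrdeg_le_natTrdeg_quotient_span_add_one f hfp
    rw [hfq] at this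
    omega

/-- Over a Noether normalization, lying over and going down lift each prime of the polynomial ring
to one of at least the same height. -/
theorem Algebra.natTrdeg_le_ringKrullDim (k B : Type) [Field k] [CommRing B] [IsDomain B]
    [Algebra k B] [Algebra.FiniteType k B] :
    (Algebra.natTrdeg k B : WithBot ℕ∞) ≤ ringKrullDim B := by
  obtain ⟨n, g, hg, hgi⟩ := exists_integral_inj_algHom_of_fg k B
  algebraize [g.toRingHom]
  have : IsScalarTower k (MvPolynomial (Fin n) k) B := .of_algebraMap_eq' g.comp_algebraMap.symm
  have : FaithfulSMul (MvPolynomial (Fin n) k) B := (faithfulSMul_iff_algebraMap_injective _ _).mpr hg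
  have : Algebra.IsIntegral (MvPolynomial (Fin n) k) B := ⟨hgi⟩
  have : IsNoetherianRing B := Algebra.FiniteType.isNoetherianRing k B
  have hn : Algebra.natTrdeg k (MvPolynomial (Fin n) k) = n := by simp [Algebra.natTrdeg]
  rw [Algebra.natTrdeg_eq_of_isIntegral (A := MvPolynomial (Fin n) k), hn]
  have hdim := ringKrullDim_add_natCard_le_ringKrullDim_mvPolynomial (R := k) (Fin n)
  rw [ringKrullDim_eq_zero_of_field, zero_add, Nat.card_fin] at hdim
  refine hdim.trans ((ringKrullDim_le_iff_height_le _).mpr fun p _ => ?_)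
  obtain ⟨P, -, hP, hPp⟩ := Ideal.exists_ideal_over_prime_of_isIntegral (S := B) p ⊥
    (((RingHom.injective_iff_ker_eq_bot _).mp hg).trans_le bot_le)
  have : P.LiesOver p := ⟨hPp.symm⟩
  have h := Ideal.height_eq_height_add_of_liesOver_of_hasGoingDown p P
  exact (WithBot.coe_le_coe.mpr (le_self_add.trans h.ge)).trans
    Ideal.height_le_ringKrullDim_of_isPrime

/-! ### The dimension of fibres over images of codimension-one points -/

/-- The dimension of the generic fibre of an extension of domains. -/
theorem Algebra.natTrdeg_le_add_of_isFractionRing {k A B K L : Type} [Field k] [CommRing A]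
    [IsDomain A] [CommRing B] [IsDomain B] [Field K] [CommRing L] [IsDomain L] [Algebra k A]
    [Algebra k B] [Algebra.FiniteType k B] [Algebra A B] [IsScalarTower k A B]
    [FaithfulSMul A B] [Algebra A K] [IsFractionRing A K] [Algebra B L] [Algebra K L] [Algebra A L]
    [IsScalarTower A B L] [IsScalarTower A K L] [Algebra.FiniteType k A] [Algebra.FiniteType K L]
    (hinj : Function.Injective (algebraMap B L)) :
    Algebra.natTrdeg k B ≤ Algebra.natTrdeg k A + Algebra.natTrdeg K L := by
  have : FaithfulSMul A L := (faithfulSMul_iff_algebraMap_injective _ _).mpr (by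
    rw [IsScalarTower.algebraMap_eq A B L]
    exact hinj.comp (FaithfulSMul.algebraMap_injective A B))
  have : FaithfulSMul K L := (faithfulSMul_iff_algebraMap_injective _ _).mpr
    (algebraMap K L).injective
  have : FaithfulSMul k A := (faithfulSMul_iff_algebraMap_injective _ _).mpr
    (algebraMap k A).injective
  have htr : Algebra.trdeg A B ≤ Algebra.trdeg K L := by
    have h1 : Algebra.trdeg A B ≤ Algebra.trdeg A L :=
      trdeg_le_of_injective (IsScalarTower.toAlgHom A B L) hinj
    have h2 := trdeg_add_eq A K (A := L)
    have : Algebra.IsAlgebraic A K := IsLocalization.isAlgebraic K (nonZeroDivisors A)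
    rw [trdeg_eq_zero (R := A) (A := K), zero_add] at h2
    exact h1.trans h2.ge
  rw [Algebra.natTrdeg, ← trdeg_add_eq k A (A := B), Algebra.natTrdeg, Algebra.natTrdeg,
    ← Cardinal.toNat_add (trdeg_lt_aleph0_of_finiteType) (trdeg_lt_aleph0_of_finiteType)]
  exact Cardinal.toNat_le_toNat (by gcongr)
    (Cardinal.add_lt_aleph0 (trdeg_lt_aleph0_of_finiteType) (trdeg_lt_aleph0_of_finiteType))

/-- Since `L` is a localization of `B ⧸ q` and an algebra over the residue field `K` of `p`, its
spectrum embeds into the fibre over `p`; only a lower bound for the fibre dimension is needed. -/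
theorem PrimeSpectrum.natTrdeg_le_topologicalKrullDim_fiber {A B K L : Type} [CommRing A]
    [CommRing B] [Field K] [CommRing L] [IsDomain L] [Algebra A B] (p : PrimeSpectrum A)
    (q : PrimeSpectrum B) [Algebra (A ⧸ p.asIdeal) K] [IsFractionRing (A ⧸ p.asIdeal) K]
    [Algebra K L] [Algebra.FiniteType K L] [Algebra (B ⧸ q.asIdeal) L]
    (M : Submonoid (B ⧸ q.asIdeal)) [IsLocalization M L]
    (hcomp : ((algebraMap (B ⧸ q.asIdeal) L).comp
      ((Ideal.Quotient.mk q.asIdeal).comp (algebraMap A B))) =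
          ((algebraMap K L).comp (algebraMap (A ⧸ p.asIdeal) K)).comp (Ideal.Quotient.mk p.asIdeal)) :
    (Algebra.natTrdeg K L : WithBot ℕ∞) ≤
      topologicalKrullDim (PrimeSpectrum.comap (algebraMap A B) ⁻¹' {p}) := by
  refine (Algebra.natTrdeg_le_ringKrullDim K L).trans ?_
  rw [← PrimeSpectrum.topologicalKrullDim_eq_ringKrullDim]
  have hmap : ∀ Q : PrimeSpectrum L, PrimeSpectrum.comap (Ideal.Quotient.mk q.asIdeal)
      (PrimeSpectrum.comap (algebraMap _ L) Q) ∈ PrimeSpectrum.comap (algebraMap A B) ⁻¹' {p} := by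
    intro Q
    rw [Set.mem_preimage, Set.mem_singleton_iff, ← PrimeSpectrum.comap_comp_apply,
      ← PrimeSpectrum.comap_comp_apply, hcomp, PrimeSpectrum.comap_comp_apply,
      PrimeSpectrum.comap_comp_apply]
    have h0 : PrimeSpectrum.comap (algebraMap K L) Q = ⊥ := Subsingleton.elim _ _
    ext1
    rw [h0]
    change ((⊥ : Ideal K).comap (algebraMap _ K)).comap (Ideal.Quotient.mk p.asIdeal) = p.asIdeal
    rw [← RingHom.ker, (RingHom.injective_iff_ker_eq_bot _).mp
      (IsFractionRing.injective (A ⧸ p.asIdeal) K), ← RingHom.ker, Ideal.mk_ker]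
  refine Topology.IsInducing.topologicalKrullDim_le (f := fun Q => ⟨_, hmap Q⟩)
    (Topology.IsInducing.codRestrict ?_ hmap)
  exact (PrimeSpectrum.isClosedEmbedding_comap_of_surjective _ _
    Ideal.Quotient.mk_surjective).isInducing.comp
      (PrimeSpectrum.localization_comap_isInducing L M)

open TensorProduct in
/-- The dimension formula for a prime of height one in an extension of domains of finite type. -/
theorem PrimeSpectrum.exists_height_le_topologicalKrullDim_fiber_add_one (k : Type) {A B : Type}
    [Field k] [CommRing A] [IsDomain A] [Algebra k A] [Algebra.FiniteType k A]
    [CommRing B] [IsDomain B] [Algebra k B] [Algebra.FiniteType k B]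
    [Algebra A B] [IsScalarTower k A B] [FaithfulSMul A B]
    (p : PrimeSpectrum A) (q : PrimeSpectrum B) (hq : q.asIdeal.height ≤ 1)
    (hqp : PrimeSpectrum.comap (algebraMap A B) q = p) :
    ∃ d : ℕ, (d : WithBot ℕ∞) ≤
      topologicalKrullDim (PrimeSpectrum.comap (algebraMap A B) ⁻¹' {p}) ∧
      p.asIdeal.height ≤ d + 1 := by
  have : q.asIdeal.LiesOver p.asIdeal := ⟨by rw [← hqp]; rfl⟩
  let K := FractionRing (A ⧸ p.asIdeal)
  -- The generic fibre of the closure of `q` over the closure of `p`; its transcendence degree over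
  -- `K` serves as `d`.
  let L := K ⊗[A ⧸ p.asIdeal] (B ⧸ q.asIdeal)
  have : Algebra.FiniteType (A ⧸ p.asIdeal) (B ⧸ q.asIdeal) :=
    Algebra.FiniteType.of_restrictScalars_finiteType k _ _
  let : Algebra (B ⧸ q.asIdeal) L := Algebra.TensorProduct.rightAlgebra
  have : IsScalarTower (A ⧸ p.asIdeal) (B ⧸ q.asIdeal) L :=
    IsScalarTower.of_algebraMap_eq' Algebra.TensorProduct.includeRight.comp_algebraMap.symm
  have hloc : IsLocalization (Algebra.algebraMapSubmonoid (B ⧸ q.asIdeal)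
    (nonZeroDivisors (A ⧸ p.asIdeal))) L :=
      IsLocalization.tensorRight K (nonZeroDivisors (A ⧸ p.asIdeal))
  have hM : Algebra.algebraMapSubmonoid (B ⧸ q.asIdeal) (nonZeroDivisors (A ⧸ p.asIdeal)) ≤
      nonZeroDivisors (B ⧸ q.asIdeal) :=
    algebraMapSubmonoid_le_nonZeroDivisors_of_faithfulSMul _ le_rfl
  have : IsDomain L := IsLocalization.isDomain_of_le_nonZeroDivisors _ hM
  have hinj : Function.Injective (algebraMap (B ⧸ q.asIdeal) L) := IsLocalization.injective L hM
  have hsum := Algebra.natTrdeg_le_add_of_isFractionRing (k := k) (A := A ⧸ p.asIdeal)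
    (B := B ⧸ q.asIdeal) (K := K) (L := L) hinj
  refine ⟨Algebra.natTrdeg K L, PrimeSpectrum.natTrdeg_le_topologicalKrullDim_fiber p q
    (Algebra.algebraMapSubmonoid (B ⧸ q.asIdeal) (nonZeroDivisors (A ⧸ p.asIdeal))) ?_, ?_⟩
  · rw [← IsScalarTower.algebraMap_eq (A ⧸ p.asIdeal) K L,
      IsScalarTower.algebraMap_eq (A ⧸ p.asIdeal) (B ⧸ q.asIdeal) L]
    rfl
  · have h1 := p.asIdeal.height_add_natTrdeg_le (k := k)
    have h2 := q.asIdeal.natTrdeg_le_natTrdeg_quotient_add_one (k := k) hq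
    have h3 := Algebra.natTrdeg_le_of_injective (IsScalarTower.toAlgHom k A B)
      (FaithfulSMul.algebraMap_injective A B)
    -- With `t = trdeg (A ⧸ p)`: `ht p + t ≤ trdeg A ≤ trdeg B ≤ trdeg (B ⧸ q) + 1 ≤ t + d + 1`, and
    -- the finite `t` cancels.
    have h4 : p.asIdeal.height + (Algebra.natTrdeg k (A ⧸ p.asIdeal) : ℕ∞) ≤
        (Algebra.natTrdeg K L + 1 : ℕ∞) + Algebra.natTrdeg k (A ⧸ p.asIdeal) := by
      refine h1.trans ?_
      norm_cast
      omega
    exact (ENat.add_le_add_iff_right (ENat.natCast_ne_top _)).mp h4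

/-! ### Normality: extension of functions, and smooth algebras -/

/-- An element of the fraction field of a noetherian normal domain which is regular at all primes
of height at most one lies in the domain. -/
theorem IsIntegrallyClosed.exists_algebraMap_eq_of_height_le_one {B K : Type} [CommRing B]
    [IsDomain B] [IsNoetherianRing B] [IsIntegrallyClosed B] [Field K] [Algebra B K]
    [IsFractionRing B K] (x : K)
    (h : ∀ P : Ideal B, P.IsPrime → P.height ≤ 1 →
      ∃ g ∉ P, ∃ b, algebraMap B K b = algebraMap B K g * x) :
    ∃ b, algebraMap B K b = x := by
  by_contra hx
  -- The annihilator in `K / B` of the class of `x` is its ideal of denominators. It lies in an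
  -- associated prime `P`, the ideal of denominators of some `y`; it remains to see that `P` has
  -- height at most one.
  let N := K ⧸ (LinearMap.range (Algebra.linearMap B K))
  have hmem : ∀ r : B, ∀ z : K, r • (Submodule.Quotient.mk z : N) = 0 ↔
      ∃ b, algebraMap B K b = algebraMap B K r * z := by
    intro r z
    rw [← Submodule.Quotient.mk_smul, Submodule.Quotient.mk_eq_zero, LinearMap.mem_range,
      Algebra.smul_def]
    rfl
  have hx0 : (Submodule.Quotient.mk x : N) ≠ 0 := fun h0 =>
    hx (by simpa using (hmem 1 x).mp (by rw [one_smul, h0]))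
  obtain ⟨P, hP, hle⟩ := exists_le_isAssociatedPrime_of_isNoetherianRing B _ hx0
  obtain ⟨hPp, n, hn⟩ := isAssociatedPrime_iff.mp hP
  obtain ⟨y, rfl⟩ := Submodule.Quotient.mk_surjective _ n
  have hPy : ∀ r, r ∈ P ↔ ∃ b, algebraMap B K b = algebraMap B K r * y := fun r => by
    rw [← hmem, hn, Submodule.mem_colon_singleton, Submodule.mem_bot]
  have hinj := IsFractionRing.injective B K
  have hPh : P.height ≤ 1 := by
    -- If `y P ⊆ P`, then `y` is integral and so lies in `B`, which is absurd. Otherwise `p y = u`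
    -- with `p ∈ P` and `u ∉ P`, and `q u = p (q y)` for `q ∈ P` makes `P` minimal over `(p)`.
    by_cases hcase : ∀ r ∈ P, ∀ b, algebraMap B K b = algebraMap B K r * y → b ∈ P
    · exfalso
      have hint : IsIntegral B y := by
        refine isIntegral_of_smul_mem_submodule (M := K)
          (Submodule.map (Algebra.linearMap B K) P) ?_ ?_ y ?_
        · obtain ⟨⟨a, b⟩, hab⟩ := IsLocalization.surj (nonZeroDivisors B) y
          have hb : (b : B) ∈ P := (hPy _).mpr ⟨a, by rw [mul_comm]; exact hab.symm⟩
          rw [Submodule.ne_bot_iff]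
          exact ⟨_, ⟨_, hb, rfl⟩, (map_ne_zero_iff _ hinj).mpr (nonZeroDivisors.ne_zero b.2)⟩
        · exact Submodule.FG.map _ (IsNoetherian.noetherian P)
        · rintro _ ⟨r, hr, rfl⟩
          obtain ⟨b, hb⟩ := (hPy r).mp hr
          exact ⟨b, hcase r hr b hb, by simp [hb, mul_comm]⟩
      obtain ⟨b, hb⟩ := IsIntegrallyClosed.algebraMap_eq_of_integral hint
      exact hPp.ne_top ((Ideal.eq_top_iff_one _).mpr ((hPy 1).mpr ⟨b, by simpa using hb⟩))
    · push Not at hcase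
      obtain ⟨p, hp, u, hu, huP⟩ := hcase
      refine Ideal.height_le_one_of_isPrincipal_of_mem_minimalPrimes (Ideal.span {p}) P ?_
      refine ⟨⟨hPp, (Ideal.span_singleton_le_iff_mem _).mpr hp⟩, ?_⟩
      rintro Q ⟨hQ, hQp⟩ hQP q hq
      obtain ⟨c, hc⟩ := (hPy q).mp hq
      have hqu : q * u = p * c := hinj (by rw [map_mul, map_mul, hu, hc]; ring)
      have : q * u ∈ Q := hqu ▸ Q.mul_mem_right _ ((Ideal.span_singleton_le_iff_mem _).mp hQp)
      exact (hQ.mem_or_mem this).resolve_right fun h => huP (hQP h)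
  obtain ⟨g, hgP, b, hb⟩ := h P hPp hPh
  refine hgP (hle ?_)
  rw [Submodule.mem_colon_singleton, Submodule.mem_bot]
  exact (hmem g x).mpr ⟨b, hb⟩

/-- An element of a noetherian domain lying in no prime of height one is a unit. -/
theorem IsNoetherianRing.isUnit_of_height_le_one {B : Type} [CommRing B] [IsNoetherianRing B]
    (x : B) (h : ∀ P : Ideal B, P.IsPrime → P.height ≤ 1 → x ∉ P) : IsUnit x := by
  by_contra hx
  obtain ⟨P, hP⟩ := Ideal.nonempty_minimalPrimes (I := Ideal.span {x})
    (by rwa [Ne, Ideal.span_singleton_eq_top])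
  exact h P hP.1.1 (Ideal.height_le_one_of_isPrincipal_of_mem_minimalPrimes _ P hP)
    ((Ideal.span_singleton_le_iff_mem _).mp hP.1.2)

open TensorProduct in
-- Integral closure commutes with smooth base change: the integral closure of `B` in `B ⊗ K` is `B ⊗
-- A = B`, and `B ⊗ K` is the fraction field of `B`, being a domain finite over `K`.
theorem Algebra.Etale.isIntegrallyClosed {A B : Type} [CommRing A] [IsDomain A]
    [IsIntegrallyClosed A] [CommRing B] [IsDomain B] [Algebra A B] [FaithfulSMul A B]
    [Algebra.Etale A B] :
    IsIntegrallyClosed B := by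
  let K := FractionRing A
  let L := B ⊗[A] K
  have hloc : IsLocalization (Algebra.algebraMapSubmonoid B (nonZeroDivisors A)) L :=
      IsLocalization.tensor K (nonZeroDivisors A)
  have hM : Algebra.algebraMapSubmonoid B (nonZeroDivisors A) ≤ nonZeroDivisors B :=
    algebraMapSubmonoid_le_nonZeroDivisors_of_faithfulSMul _ le_rfl
  have : IsDomain L := IsLocalization.isDomain_of_le_nonZeroDivisors _ hM
  have hfield : IsField L := by
    have e : L ≃+* K ⊗[A] B := (Algebra.TensorProduct.comm A B K).toRingEquiv
    have : IsDomain (K ⊗[A] B) := e.symm.toMulEquiv.isDomain _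
    have : Module.Finite K (K ⊗[A] B) := Algebra.FormallyUnramified.finite_of_free K _
    exact e.isField (isField_of_isIntegral_of_isField' (Field.toIsField K))
  let : Field L := hfield.toField
  have hinj : Function.Injective (algebraMap B L) := IsLocalization.injective L hM
  have : FaithfulSMul B L := (faithfulSMul_iff_algebraMap_injective _ _).mpr hinj
  have : IsFractionRing B L := IsFractionRing.of_field B L fun z => by
    obtain ⟨⟨a, b⟩, hab⟩ := IsLocalization.surj (Algebra.algebraMapSubmonoid B (nonZeroDivisors A)) z
    refine ⟨a, b, ?_⟩
    rw [eq_div_iff ((map_ne_zero_iff _ hinj).mpr (nonZeroDivisors.ne_zero (hM b.2)))]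
    exact hab
  refine (isIntegrallyClosed_iff L).mpr fun {x} hx => ?_
  obtain ⟨t, ht⟩ := (TensorProduct.toIntegralClosure_bijective_of_smooth (R := A) (S := B)
    (B := K)).2 ⟨x, hx⟩
  have ht' : Algebra.TensorProduct.map (.id B B) (integralClosure A K).val t = x :=
    congrArg Subtype.val ht
  rw [← ht']
  clear ht ht'
  induction t with
  | zero => exact ⟨0, by simp⟩
  | add a b ha hb =>
    obtain ⟨a', ha⟩ := ha
    obtain ⟨b', hb⟩ := hb
    exact ⟨a' + b', by rw [map_add, map_add, ha, hb]⟩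
  | tmul b y =>
    obtain ⟨a, ha⟩ := IsIntegrallyClosed.algebraMap_eq_of_integral y.2
    refine ⟨a • b, ?_⟩
    rw [Algebra.TensorProduct.map_tmul, AlgHom.id_apply, Subalgebra.val_apply, ← ha,
      Algebra.TensorProduct.algebraMap_apply, Algebra.algebraMap_self, RingHom.id_apply,
      TensorProduct.smul_tmul, Algebra.algebraMap_eq_smul_one]

theorem IsIntegrallyClosed.of_localization_away {B : Type} [CommRing B] [IsDomain B]
    (h : ∀ m : PrimeSpectrum B, ∃ f ∉ m.asIdeal, IsIntegrallyClosed (Localization.Away f)) :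
    IsIntegrallyClosed B := by
  let K := FractionRing B
  refine (isIntegrallyClosed_iff K).mpr fun {x} hx => ?_
  -- The ideal of denominators of `x`. If it lay in a maximal ideal `m`, then normality of `B_f`
  -- with `f ∉ m` would put a power of `f` into it.
  let I : Ideal B := (⊥ : Submodule B (K ⧸ LinearMap.range (Algebra.linearMap B K))).colon
    {Submodule.Quotient.mk x}
  have hI : ∀ r, r ∈ I ↔ ∃ b, algebraMap B K b = algebraMap B K r * x := by
    intro r
    rw [Submodule.mem_colon_singleton, Submodule.mem_bot, ← Submodule.Quotient.mk_smul,
      Submodule.Quotient.mk_eq_zero, LinearMap.mem_range, Algebra.smul_def]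
    rfl
  suffices I = ⊤ by simpa using (hI 1).mp (this ▸ Submodule.mem_top)
  by_contra hne
  obtain ⟨m, hm, hIm⟩ := Ideal.exists_le_maximal I hne
  obtain ⟨f, hfm, hf⟩ := h ⟨m, hm.isPrime⟩
  have hf0 : f ≠ 0 := by rintro rfl; exact hfm (zero_mem _)
  have hle : Submonoid.powers f ≤ nonZeroDivisors B :=
    powers_le_nonZeroDivisors_of_noZeroDivisors hf0
  let := IsLocalization.localizationAlgebraOfSubmonoidLe (Localization.Away f) K _ _ hle
  have : IsScalarTower B (Localization.Away f) K :=
    IsLocalization.localization_isScalarTower_of_submonoid_le _ _ _ _ hle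
  have : IsFractionRing (Localization.Away f) K :=
    IsFractionRing.isFractionRing_of_isDomain_of_isLocalization (Submonoid.powers f) _ _
  obtain ⟨z, hz⟩ := IsIntegrallyClosed.algebraMap_eq_of_integral (hx.tower_top (A := Localization.Away f))
  obtain ⟨⟨b, ⟨_, n, rfl⟩⟩, hb⟩ := IsLocalization.surj (Submonoid.powers f) z
  refine hfm (hm.isPrime.mem_of_pow_mem n (hIm ((hI _).mpr ⟨b, ?_⟩)))
  rw [← hz, IsScalarTower.algebraMap_apply B (Localization.Away f) K, ← hb, map_mul, mul_comm,
    ← IsScalarTower.algebraMap_apply]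

/-- A smooth algebra is locally étale over a polynomial ring, which is normal. -/
theorem Algebra.Smooth.isIntegrallyClosed (k : Type) {B : Type} [Field k] [CommRing B] [IsDomain B]
    [Algebra k B] [Algebra.Smooth k B] : IsIntegrallyClosed B := by
  refine .of_localization_away fun m => ?_
  obtain ⟨f, hfm, n, _, _, _⟩ :=
    Algebra.IsSmoothAt.exists_isStandardEtale_mvPolynomial (R := k) (p := m.asIdeal)
  have hf0 : f ≠ 0 := by rintro rfl; exact hfm (zero_mem _)
  have : IsDomain (Localization.Away f) := IsLocalization.isDomain_localization
    (powers_le_nonZeroDivisors_of_noZeroDivisors hf0)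
  -- Étale algebras are flat, so nonzero polynomials act injectively and cannot map to zero.
  have : FaithfulSMul (MvPolynomial (Fin n) k) (Localization.Away f) := by
    refine (faithfulSMul_iff_algebraMap_injective _ _).mpr
      ((injective_iff_map_eq_zero _).mpr fun r hr => ?_)
    by_contra hr0
    have hreg : IsSMulRegular (Localization.Away f) r :=
      Module.Flat.isSMulRegular_of_nonZeroDivisors (mem_nonZeroDivisors_of_ne_zero hr0)
    refine one_ne_zero (α := Localization.Away f) (hreg ?_)
    simp [Algebra.smul_def, hr]
  exact ⟨f, hfm, Algebra.Etale.isIntegrallyClosed (A := MvPolynomial (Fin n) k)⟩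

/-! ### Calculus of Kähler forms and their localization -/

namespace SymplRes

section Forms

variable {A B C : Type} [CommRing A] [CommRing B] [CommRing C] [Algebra ℂ A] [Algebra ℂ B]
  [Algebra ℂ C]

/-- The map on Kähler differentials induced by a homomorphism of `ℂ`-algebras. -/
noncomputable def kaehlerMap (φ : A →ₐ[ℂ] B) : Ω[A⁄ℂ] →+ Ω[B⁄ℂ] :=
  letI : Algebra A B := φ.toRingHom.toAlgebra
  haveI : IsScalarTower ℂ A B := IsScalarTower.of_algebraMap_eq' φ.comp_algebraMap.symm
  (KaehlerDifferential.map ℂ ℂ A B).toAddMonoidHom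

theorem kaehlerMap_smul (φ : A →ₐ[ℂ] B) (a : A) (x : Ω[A⁄ℂ]) :
    kaehlerMap φ (a • x) = φ a • kaehlerMap φ x := by
  let : Algebra A B := φ.toRingHom.toAlgebra
  have : IsScalarTower ℂ A B := IsScalarTower.of_algebraMap_eq' φ.comp_algebraMap.symm
  exact (KaehlerDifferential.map ℂ ℂ A B).map_smul a x

@[simp]
theorem kaehlerMap_D (φ : A →ₐ[ℂ] B) (a : A) :
    kaehlerMap φ (KaehlerDifferential.D ℂ A a) = KaehlerDifferential.D ℂ B (φ a) := by
  let : Algebra A B := φ.toRingHom.toAlgebra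
  have : IsScalarTower ℂ A B := IsScalarTower.of_algebraMap_eq' φ.comp_algebraMap.symm
  exact KaehlerDifferential.map_D ℂ ℂ A B a

theorem AlgForm.map_ιMulti (φ : A →ₐ[ℂ] B) {p : ℕ} (v : Fin p → Ω[A⁄ℂ]) :
    AlgForm.map φ p (exteriorPower.ιMulti A p v) =
      exteriorPower.ιMulti B p (fun i => kaehlerMap φ (v i)) := by
  let : Algebra A B := φ.toRingHom.toAlgebra
  have : IsScalarTower ℂ A B := IsScalarTower.of_algebraMap_eq' φ.comp_algebraMap.symm
  exact exteriorPower.alternatingMapLinearEquiv_apply_ιMulti _ _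

theorem AlgForm.map_smul (φ : A →ₐ[ℂ] B) {p : ℕ} (a : A) (ω : AlgForm A p) :
    AlgForm.map φ p (a • ω) = φ a • AlgForm.map φ p ω := by
  let : Algebra A B := φ.toRingHom.toAlgebra
  have : IsScalarTower ℂ A B := IsScalarTower.of_algebraMap_eq' φ.comp_algebraMap.symm
  exact (LinearMap.map_smul (exteriorPower.alternatingMapLinearEquiv _ :
    AlgForm A p →ₗ[A] AlgForm B p) a ω :)

@[elab_as_elim]
theorem AlgForm.induction {p : ℕ} {P : AlgForm A p → Prop}
    (h₁ : ∀ v, P (exteriorPower.ιMulti A p v)) (h₂ : ∀ x y, P x → P y → P (x + y))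
    (h₃ : ∀ (a : A) x, P x → P (a • x)) (ω : AlgForm A p) : P ω := by
  have hω : ω ∈ Submodule.span A (Set.range (exteriorPower.ιMulti A p (M := Ω[A⁄ℂ]))) := by
    rw [exteriorPower.ιMulti_span]; trivial
  induction hω using Submodule.span_induction with
  | mem x hx => obtain ⟨v, rfl⟩ := hx; exact h₁ v
  | zero =>
    have := h₃ 0 _ (h₁ 0)
    rwa [zero_smul] at this
  | add x y _ _ hx hy => exact h₂ x y hx hy
  | smul a x _ hx => exact h₃ a x hx

theorem kaehlerMap_comp (φ : A →ₐ[ℂ] B) (ψ : B →ₐ[ℂ] C) (x : Ω[A⁄ℂ]) :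
    kaehlerMap ψ (kaehlerMap φ x) = kaehlerMap (ψ.comp φ) x := by
  have hx : x ∈ Submodule.span A (Set.range (KaehlerDifferential.D ℂ A)) := by
    rw [KaehlerDifferential.span_range_derivation]; trivial
  induction hx using Submodule.span_induction with
  | mem x hx => obtain ⟨a, rfl⟩ := hx; simp
  | zero => simp
  | add x y _ _ hx hy => simp [hx, hy]
  | smul a x _ hx => simp [kaehlerMap_smul, hx]

theorem AlgForm.map_map (φ : A →ₐ[ℂ] B) (ψ : B →ₐ[ℂ] C) {p : ℕ} (ω : AlgForm A p) :
    AlgForm.map ψ p (AlgForm.map φ p ω) = AlgForm.map (ψ.comp φ) p ω := by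
  induction ω using AlgForm.induction with
  | h₁ v => simp only [AlgForm.map_ιMulti, kaehlerMap_comp]
  | h₂ x y hx hy => simp only [map_add, hx, hy]
  | h₃ a x hx => simp only [AlgForm.map_smul, hx, AlgHom.comp_apply]

theorem AlgForm.eval_ιMulti {K : Type} [CommRing K] [Algebra A K] {p : ℕ}
    (L : Fin p → (Ω[A⁄ℂ] →ₗ[A] K)) (v : Fin p → Ω[A⁄ℂ]) :
    AlgForm.eval L (exteriorPower.ιMulti A p v) = Matrix.det (fun i j => L j (v i)) :=
  exteriorPower.alternatingMapLinearEquiv_apply_ιMulti _ _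

theorem AlgForm.eval_two {K : Type} [CommRing K] [Algebra A K]
    (u v : Ω[A⁄ℂ] →ₗ[A] K) (x : Fin 2 → Ω[A⁄ℂ]) :
    AlgForm.eval ![u, v] (exteriorPower.ιMulti A 2 x) = u (x 0) * v (x 1) - v (x 0) * u (x 1) := by
  rw [AlgForm.eval_ιMulti]
  exact Matrix.det_fin_two _

theorem AlgForm.eval_map (φ : A →ₐ[ℂ] B) {K K' : Type} [CommRing K] [Algebra A K] [CommRing K']
    [Algebra B K'] (ψ : K →+* K') (hψ : ∀ a, ψ (algebraMap A K a) = algebraMap B K' (φ a)) {p : ℕ}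
    (L : Fin p → (Ω[A⁄ℂ] →ₗ[A] K)) (L' : Fin p → (Ω[B⁄ℂ] →ₗ[B] K'))
    (hL : ∀ j x, L' j (kaehlerMap φ x) = ψ (L j x)) (ω : AlgForm A p) :
    AlgForm.eval L' (AlgForm.map φ p ω) = ψ (AlgForm.eval L ω) := by
  induction ω using AlgForm.induction with
  | h₁ v =>
    rw [AlgForm.map_ιMulti, AlgForm.eval_ιMulti, AlgForm.eval_ιMulti]
    exact (congrArg Matrix.det (Matrix.ext fun i j => hL _ _)).trans
      (RingHom.map_det ψ (Matrix.of fun i j => L j (v i))).symm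
  | h₂ x y hx hy => simp only [map_add, hx, hy]
  | h₃ a x hx =>
    simp only [AlgForm.map_smul, hx, LinearMap.map_smul, Algebra.smul_def, map_mul, hψ]

theorem AlgForm.eval_two_map (φ : A →ₐ[ℂ] B) {K K' : Type} [CommRing K] [Algebra A K] [CommRing K']
    [Algebra B K'] (ψ : K →+* K') (hψ : ∀ a, ψ (algebraMap A K a) = algebraMap B K' (φ a))
    {u v : Ω[A⁄ℂ] →ₗ[A] K} {u' v' : Ω[B⁄ℂ] →ₗ[B] K'}
    (hu : ∀ x, u' (kaehlerMap φ x) = ψ (u x)) (hv : ∀ x, v' (kaehlerMap φ x) = ψ (v x))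
    (ω : AlgForm A 2) :
    AlgForm.eval ![u', v'] (AlgForm.map φ 2 ω) = ψ (AlgForm.eval ![u, v] ω) :=
  AlgForm.eval_map φ ψ hψ _ _ (Fin.forall_fin_two.mpr ⟨hu, hv⟩) ω

/-- The wedge product of two `1`-forms. -/
noncomputable def wedge (x y : Ω[A⁄ℂ]) : AlgForm A 2 := exteriorPower.ιMulti A 2 ![x, y]

theorem wedge_sum_smul_left {ι : Type} (s : Finset ι) (c : ι → A) (e : ι → Ω[A⁄ℂ]) (y : Ω[A⁄ℂ]) :
    wedge (∑ i ∈ s, c i • e i) y = ∑ i ∈ s, c i • wedge (e i) y := by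
  have h : ∀ x, wedge x y = (exteriorPower.ιMulti A 2).toMultilinearMap.toLinearMap ![0, y] 0 x := by
    intro x
    have : ![x, y] = Function.update ![0, y] 0 x := by
      funext i
      fin_cases i <;> rfl
    rw [MultilinearMap.toLinearMap_apply, wedge, this]
    rfl
  simp only [h, map_sum, _root_.map_smul]

theorem wedge_sum_smul_right {ι : Type} (s : Finset ι) (c : ι → A) (e : ι → Ω[A⁄ℂ]) (x : Ω[A⁄ℂ]) :
    wedge x (∑ i ∈ s, c i • e i) = ∑ i ∈ s, c i • wedge x (e i) := by
  have h : ∀ y, wedge x y = (exteriorPower.ιMulti A 2).toMultilinearMap.toLinearMap ![x, 0] 1 y := by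
    intro y
    have : ![x, y] = Function.update ![x, 0] 1 y := by
      funext i
      fin_cases i <;> rfl
    rw [MultilinearMap.toLinearMap_apply, wedge, this]
    rfl
  simp only [h, map_sum, _root_.map_smul]

theorem wedge_swap (x y : Ω[A⁄ℂ]) : wedge y x = - wedge x y := by
  have := (exteriorPower.ιMulti A 2).map_swap ![x, y] (i := 0) (j := 1) (by decide)
  rw [wedge, wedge, ← this]
  congr 1
  ext i
  fin_cases i <;> rfl

theorem AlgForm.map_wedge (φ : A →ₐ[ℂ] B) (x y : Ω[A⁄ℂ]) :
    AlgForm.map φ 2 (wedge x y) = wedge (kaehlerMap φ x) (kaehlerMap φ y) := by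
  rw [wedge, AlgForm.map_ιMulti, wedge]
  congr 1
  ext i
  fin_cases i <;> rfl

/-- A `2`-form on a ring with a dual basis for its differentials is determined by its values. -/
theorem AlgForm.sum_eval_smul_wedge {n : ℕ} (e : Fin n → Ω[A⁄ℂ]) (f : Fin n → (Ω[A⁄ℂ] →ₗ[A] A))
    (hef : ∀ x, ∑ i, f i x • e i = x) (ω : AlgForm A 2) :
    ∑ i, ∑ j, AlgForm.eval ![f i, f j] ω • wedge (e i) (e j) = (2 : A) • ω := by
  induction ω using AlgForm.induction with
  | h₁ v =>
    have h : ∀ x y : Ω[A⁄ℂ], ∑ i, ∑ j, (f i x * f j y) • wedge (e i) (e j) = wedge x y := by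
      intro x y
      conv_rhs => rw [← hef x, ← hef y, wedge_sum_smul_left]
      simp only [wedge_sum_smul_right, Finset.smul_sum, mul_smul]
    have hv : exteriorPower.ιMulti A 2 v = wedge (v 0) (v 1) := by
      rw [wedge]
      congr 1
      ext i
      fin_cases i <;> rfl
    have hs : ∀ (a b : A) (w : AlgForm A 2), (a - b) • w = a • w - b • w :=
      fun a b w => sub_smul a b w
    simp only [AlgForm.eval_two, hs, Finset.sum_sub_distrib]
    rw [h, hv, two_smul]
    have : ∑ i, ∑ j, (f j (v 0) * f i (v 1)) • wedge (e i) (e j) = wedge (v 1) (v 0) := by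
      rw [← h]
      simp only [mul_comm]
    rw [this, wedge_swap (v 0) (v 1), sub_neg_eq_add]
  | h₂ x y hx hy => simp only [map_add, add_smul, Finset.sum_add_distrib, hx, hy, smul_add]
  | h₃ a x hx => 
    rw [smul_comm, ← hx, Finset.smul_sum]
    simp only [LinearMap.map_smul, smul_eq_mul, mul_smul, Finset.smul_sum]

theorem AlgForm.eval_eq_sum {K : Type} [CommRing K] [Algebra A K] {n : ℕ} (e : Fin n → Ω[A⁄ℂ])
    (f : Fin n → (Ω[A⁄ℂ] →ₗ[A] A)) (hef : ∀ x, ∑ i, f i x • e i = x) (ω : AlgForm A 2)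
    (u v : Ω[A⁄ℂ] →ₗ[A] K) :
    AlgForm.eval ![u, v] ω =
      ∑ i, ∑ j, u (e i) * algebraMap A K (AlgForm.eval ![f i, f j] ω) * v (e j) := by
  induction ω using AlgForm.induction with
  | h₁ x =>
    have h : ∀ (w : Ω[A⁄ℂ] →ₗ[A] K) y, w y = ∑ i, algebraMap A K (f i y) * w (e i) := by
      intro w y
      conv_lhs => rw [← hef y, map_sum]
      simp only [LinearMap.map_smul, Algebra.smul_def]
    simp only [AlgForm.eval_two]
    rw [h u (x 0), h v (x 1), h v (x 0), h u (x 1), Finset.sum_mul_sum, Finset.sum_mul_sum,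
      Finset.sum_comm (f := fun i j => _ * v (e i) * _), ← Finset.sum_sub_distrib]
    refine Finset.sum_congr rfl fun i _ => ?_
    rw [← Finset.sum_sub_distrib]
    refine Finset.sum_congr rfl fun j _ => ?_
    rw [map_sub, map_mul, map_mul]
    ring
  | h₂ x y hx hy => simp only [map_add, mul_add, add_mul, Finset.sum_add_distrib, hx, hy]
  | h₃ a x hx =>
    rw [LinearMap.map_smul, hx, Algebra.smul_def, Finset.mul_sum]
    refine Finset.sum_congr rfl fun i _ => ?_
    rw [Finset.mul_sum]
    refine Finset.sum_congr rfl fun j _ => ?_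
    rw [LinearMap.map_smul, smul_eq_mul, map_mul]
    ring

/-- The double sum in `AlgForm.sum_eval_smul_wedge` runs over ordered pairs and yields `2ω`;
recovering `ω` requires dividing by two. -/
theorem isUnit_two : IsUnit (2 : A) := by
  have : IsUnit (2 : ℂ) := by simp
  simpa only [map_ofNat] using this.map (algebraMap ℂ A)

/-- The universal property of differentials under a localization. -/
structure IsKaehlerBaseChange (φ : A →ₐ[ℂ] B) : Prop where
  exists_lift : ∀ (K : Type) [AddCommGroup K] [Module B K] (ℓ : Ω[A⁄ℂ] →+ K),
    (∀ a x, ℓ (a • x) = φ a • ℓ x) → ∃ ℓ' : Ω[B⁄ℂ] →ₗ[B] K, ∀ x, ℓ' (kaehlerMap φ x) = ℓ x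
  span_eq_top : Submodule.span B (Set.range (kaehlerMap φ)) = ⊤

/-- Localizations are formally étale, so the differentials of `B` are the base change of those of
`A`. -/
theorem IsKaehlerBaseChange.of_isLocalization (φ : A →ₐ[ℂ] B) (M : Submonoid A)
    (h : letI := φ.toRingHom.toAlgebra; IsLocalization M B) : IsKaehlerBaseChange φ := by
  let : Algebra A B := φ.toRingHom.toAlgebra
  have : IsScalarTower ℂ A B := IsScalarTower.of_algebraMap_eq' φ.comp_algebraMap.symm
  have : IsLocalization M B := h
  have := Algebra.FormallyEtale.of_isLocalization (Rₘ := B) M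
  have hbc := KaehlerDifferential.isBaseChange_of_formallyEtale ℂ A B
  refine ⟨fun K _ _ ℓ hℓ => ?_, ?_⟩
  · let : Module A K := Module.compHom K φ.toRingHom
    have : IsScalarTower A B K := ⟨fun a b k => by
      rw [Algebra.smul_def, mul_smul]; rfl⟩
    let ℓ₀ : Ω[A⁄ℂ] →ₗ[A] K := { ℓ with map_smul' := hℓ }
    exact ⟨hbc.lift ℓ₀, fun x => hbc.lift_eq ℓ₀ x⟩
  · rw [eq_top_iff, ← KaehlerDifferential.span_range_map_derivation_of_isLocalization ℂ A B M]
    refine Submodule.span_mono ?_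
    rintro _ ⟨a, rfl⟩
    exact ⟨KaehlerDifferential.D ℂ A a, rfl⟩

theorem IsKaehlerBaseChange.hom_ext {φ : A →ₐ[ℂ] B} (h : IsKaehlerBaseChange φ) {K : Type}
    [AddCommGroup K] [Module B K] {f g : Ω[B⁄ℂ] →ₗ[B] K}
    (hfg : ∀ x, f (kaehlerMap φ x) = g (kaehlerMap φ x)) : f = g :=
  LinearMap.ext_on_range h.span_eq_top hfg

theorem IsKaehlerBaseChange.exists_extend {φ : A →ₐ[ℂ] B} (h : IsKaehlerBaseChange φ)
    (f : Ω[A⁄ℂ] →ₗ[A] A) : ∃ f' : Ω[B⁄ℂ] →ₗ[B] B, ∀ x, f' (kaehlerMap φ x) = φ (f x) :=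
  h.exists_lift B ((φ : A →+ B).comp f.toAddMonoidHom) fun a x => by simp

theorem IsKaehlerBaseChange.dual_basis {φ : A →ₐ[ℂ] B} (h : IsKaehlerBaseChange φ) {n : ℕ}
    {e : Fin n → Ω[A⁄ℂ]} {f : Fin n → (Ω[A⁄ℂ] →ₗ[A] A)} (hef : ∀ x, ∑ i, f i x • e i = x)
    {f' : Fin n → (Ω[B⁄ℂ] →ₗ[B] B)} (hf : ∀ i x, f' i (kaehlerMap φ x) = φ (f i x)) (y : Ω[B⁄ℂ]) :
    ∑ i, f' i y • kaehlerMap φ (e i) = y := by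
  have : ∑ i, (f' i).smulRight (kaehlerMap φ (e i)) = LinearMap.id := h.hom_ext fun x => by
    simp only [LinearMap.sum_apply, LinearMap.smulRight_apply, hf, LinearMap.id_apply]
    conv_rhs => rw [← hef x]
    simp only [map_sum, kaehlerMap_smul]
  simpa using LinearMap.congr_fun this y

theorem exists_dual_basis [Module.Finite A Ω[A⁄ℂ]] [Module.Projective A Ω[A⁄ℂ]] :
    ∃ (n : ℕ) (e : Fin n → Ω[A⁄ℂ]) (f : Fin n → (Ω[A⁄ℂ] →ₗ[A] A)), ∀ x, ∑ i, f i x • e i = x := by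
  obtain ⟨n, g, hg⟩ := Module.Finite.exists_fin' A Ω[A⁄ℂ]
  obtain ⟨s, hs⟩ := Module.projective_lifting_property g LinearMap.id hg
  refine ⟨n, fun i => g (Pi.single i 1), fun i => LinearMap.proj i ∘ₗ s, fun x => ?_⟩
  have h : ∑ i, s x i • (Pi.single i 1 : Fin n → A) = s x := by
    ext j
    simp [Finset.sum_apply, Pi.single_apply]
  simp only [LinearMap.comp_apply, LinearMap.proj_apply]
  conv_rhs => rw [← LinearMap.id_apply (R := A) x, ← hs, LinearMap.comp_apply, ← h, map_sum]
  simp only [LinearMap.map_smul]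

/-- Dual basis functionals extend to `B`, so the coefficients of the image form are the images of
the coefficients of `ω`. -/
theorem AlgForm.map_injective [Module.Finite A Ω[A⁄ℂ]] [Module.Projective A Ω[A⁄ℂ]]
    {φ : A →ₐ[ℂ] B} (h : IsKaehlerBaseChange φ) (hφ : Function.Injective φ) :
    Function.Injective (AlgForm.map φ 2) := by
  rw [injective_iff_map_eq_zero]
  intro ω hω
  obtain ⟨n, e, f, hef⟩ := exists_dual_basis (A := A)
  choose f' hf' using fun i => h.exists_extend (f i)
  have h0 : ∀ i j, AlgForm.eval ![f i, f j] ω = 0 := fun i j => hφ <| by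
    have := AlgForm.eval_two_map φ φ.toRingHom (fun _ => rfl) (hf' i) (hf' j) ω
    rw [hω, map_zero] at this
    rw [map_zero]
    exact this.symm
  have := AlgForm.sum_eval_smul_wedge e f hef ω
  simp only [h0, zero_smul, Finset.sum_const_zero] at this
  exact (isUnit_two.smul_eq_zero.mp this.symm)

end Forms

end SymplRes

/-! ### Descent of closedness and nondegeneracy along localizations -/

namespace SymplRes

section Symplectic

variable {A B : Type} [CommRing A] [CommRing B] [Algebra ℂ A] [Algebra ℂ B]

theorem liftKaehlerDifferential_kaehlerMap {φ : A →ₐ[ℂ] B} {D : Derivation ℂ A A}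
    {D' : Derivation ℂ B B} (h : ∀ a, D' (φ a) = φ (D a)) (x : Ω[A⁄ℂ]) :
    D'.liftKaehlerDifferential (kaehlerMap φ x) = φ (D.liftKaehlerDifferential x) := by
  have hx : x ∈ Submodule.span A (Set.range (KaehlerDifferential.D ℂ A)) := by
    rw [KaehlerDifferential.span_range_derivation]; trivial
  induction hx using Submodule.span_induction with
  | mem x hx => obtain ⟨a, rfl⟩ := hx; simp [h]
  | zero => simp
  | add x y _ _ hx hy => simp [hx, hy]
  | smul a x _ hx => simp [kaehlerMap_smul, hx]

theorem AlgForm.evalDer_map {φ : A →ₐ[ℂ] B} {D₁ D₂ : Derivation ℂ A A}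
    {D₁' D₂' : Derivation ℂ B B} (h₁ : ∀ a, D₁' (φ a) = φ (D₁ a)) (h₂ : ∀ a, D₂' (φ a) = φ (D₂ a))
    (ω : AlgForm A 2) :
    AlgForm.evalDer (AlgForm.map φ 2 ω) D₁' D₂' = φ (AlgForm.evalDer ω D₁ D₂) :=
  AlgForm.eval_two_map φ φ.toRingHom (fun _ => rfl) (liftKaehlerDifferential_kaehlerMap h₁)
    (liftKaehlerDifferential_kaehlerMap h₂) ω

theorem IsKaehlerBaseChange.exists_derivation {φ : A →ₐ[ℂ] B} (h : IsKaehlerBaseChange φ)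
    (D : Derivation ℂ A A) : ∃ D' : Derivation ℂ B B, ∀ a, D' (φ a) = φ (D a) := by
  obtain ⟨f, hf⟩ := h.exists_extend D.liftKaehlerDifferential
  refine ⟨f.compDer (KaehlerDifferential.D ℂ B), fun a => ?_⟩
  have := hf (KaehlerDifferential.D ℂ A a)
  simpa using this

/-- Derivations extend to the localization compatibly with brackets, so the identity over `B` is the
image of the one over `A`. -/
theorem AlgForm.IsClosed.of_map {φ : A →ₐ[ℂ] B} (h : IsKaehlerBaseChange φ)
    (hφ : Function.Injective φ) {ω : AlgForm A 2} (hω : (AlgForm.map φ 2 ω).IsClosed) :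
    ω.IsClosed := by
  intro D₁ D₂ D₃
  obtain ⟨D₁', h₁⟩ := h.exists_derivation D₁
  obtain ⟨D₂', h₂⟩ := h.exists_derivation D₂
  obtain ⟨D₃', h₃⟩ := h.exists_derivation D₃
  have hb : ∀ {D E : Derivation ℂ A A} {D' E' : Derivation ℂ B B}, (∀ a, D' (φ a) = φ (D a)) →
      (∀ a, E' (φ a) = φ (E a)) → ∀ a, ⁅D', E'⁆ (φ a) = φ (⁅D, E⁆ a) := by
    intro D E D' E' hD hE a
    simp [Derivation.commutator_apply, hD, hE]
  have := hω D₁' D₂' D₃'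
  simp only [AlgForm.evalDer_map h₁ h₂, AlgForm.evalDer_map h₁ h₃, AlgForm.evalDer_map h₂ h₃,
    AlgForm.evalDer_map (hb h₁ h₂) h₃, AlgForm.evalDer_map (hb h₁ h₃) h₂,
    AlgForm.evalDer_map (hb h₂ h₃) h₁, h₁, h₂, h₃] at this
  apply hφ
  simpa only [map_zero, map_add, map_sub] using this

/-- Both rings have the same tangent vectors at the point: `u` lifts to `B`, and every test vector
`v'` on `B` restricts to one on `A`. -/
theorem AlgForm.NondegenerateAt.of_map {φ : A →ₐ[ℂ] B} (h : IsKaehlerBaseChange φ) {K : Type}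
    [Field K] {e : A →+* K} {e' : B →+* K} (he : ∀ a, e' (φ a) = e a) {ω : AlgForm A 2}
    (hω : AlgForm.NondegenerateAt e' (AlgForm.map φ 2 ω)) : AlgForm.NondegenerateAt e ω := by
  let : Algebra A K := e.toAlgebra
  let : Algebra B K := e'.toAlgebra
  intro u hu
  obtain ⟨u', hu'⟩ := h.exists_lift K u.toAddMonoidHom fun a x => by
    change u (a • x) = e' (φ a) * u x
    rw [he, LinearMap.map_smul]
    rfl
  have h0 : u' = 0 := hω u' fun v' => by
    let v : Ω[A⁄ℂ] →ₗ[A] K :=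
      { toFun := fun x => v' (kaehlerMap φ x)
        map_add' := fun x y => by rw [map_add, map_add]
        map_smul' := fun a x => by
          rw [kaehlerMap_smul, LinearMap.map_smul]
          change e' (φ a) * _ = e a * _
          rw [he] }
    rw [AlgForm.eval_two_map φ (RingHom.id K) (fun a => (he a).symm) (u := u) (v := v) hu'
      (fun _ => rfl) ω, hu v, map_zero]
  ext x
  have := hu' x
  rw [h0] at this
  exact this.symm

/-- The matrix of a `2`-form with respect to a basis of the `1`-forms. -/
noncomputable def AlgForm.toMatrix {n : ℕ} (b : Module.Basis (Fin n) A Ω[A⁄ℂ]) (ω : AlgForm A 2) :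
    Matrix (Fin n) (Fin n) A :=
  Matrix.of fun i j => AlgForm.eval ![b.coord i, b.coord j] ω

/-- Turns nondegeneracy into the nonvanishing of one function, to which the principal ideal theorem
applies. -/
theorem AlgForm.nondegenerateAt_iff {n : ℕ} (b : Module.Basis (Fin n) A Ω[A⁄ℂ]) (ω : AlgForm A 2)
    {K : Type} [Field K] (e : A →+* K) :
    AlgForm.NondegenerateAt e ω ↔ e (ω.toMatrix b).det ≠ 0 := by
  let : Algebra A K := e.toAlgebra
  have hev : ∀ u v : Ω[A⁄ℂ] →ₗ[A] K, AlgForm.eval ![u, v] ω =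
      Matrix.vecMul (fun i => u (b i)) (e.mapMatrix (ω.toMatrix b)) ⬝ᵥ (fun j => v (b j)) := by
    intro u v
    rw [AlgForm.eval_eq_sum b b.coord (fun x => by simp), Finset.sum_comm]
    simp only [dotProduct, Matrix.vecMul, Finset.sum_mul]
    rfl
  rw [RingHom.map_det]
  constructor
  · intro hω hdet
    obtain ⟨w, hw0, hw⟩ := Matrix.exists_vecMul_eq_zero_iff.mpr hdet
    have hwu : ∀ i, b.constr A w (b i) = w i := fun i => by simp
    have : b.constr A w = 0 := hω _ fun v => by
      rw [hev, funext hwu, hw, zero_dotProduct]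
    refine hw0 (funext fun i => ?_)
    rw [← hwu, this]
    rfl
  · intro hdet u hu
    have : Matrix.vecMul (fun i => u (b i)) (e.mapMatrix (ω.toMatrix b)) = 0 := by
      ext j
      have := hu (b.constr A (Pi.single j 1))
      rw [hev] at this
      simpa using this
    by_contra hne
    refine hdet (Matrix.exists_vecMul_eq_zero_iff.mp ⟨_, fun h0 => hne (b.ext fun i => ?_), this⟩)
    exact congrFun h0 i

end Symplectic

end SymplRes

/-! ### Sections over affine opens and extension of functions -/

namespace SymplRes

section Sections

variable {X Y : Scheme.{0}} (g : Y ⟶ Spec (.of ℂ))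

theorem smooth_sections [Smooth g] {V : Y.Opens} (hV : IsAffineOpen V) :
    Algebra.Smooth ℂ (Sections g V) := by
  have h1 := g.smooth_appLE (isAffineOpen_top _) hV (le_preimage_top g V)
  have h2 := RingHom.Smooth.respectsIso.2 (g.appLE ⊤ V (le_preimage_top g V)).hom
    (Scheme.ΓSpecIso (.of ℂ)).symm.commRingCatIsoToRingEquiv h1
  exact h2

theorem finiteType_sections [LocallyOfFiniteType g] {V : Y.Opens} (hV : IsAffineOpen V) :
    Algebra.FiniteType ℂ (Sections g V) := by
  have h1 := g.finiteType_appLE (isAffineOpen_top _) hV (le_preimage_top g V)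
  have h2 := RingHom.finiteType_respectsIso.2 (g.appLE ⊤ V (le_preimage_top g V)).hom
    (Scheme.ΓSpecIso (.of ℂ)).symm.commRingCatIsoToRingEquiv h1
  exact h2

theorem isDomain_sections [IsIntegral Y] (V : Y.Opens) [Nonempty V] : IsDomain (Sections g V) :=
  inferInstanceAs (IsDomain Γ(Y, V))

theorem resHom_comp {U V W : Y.Opens} (h : V ≤ U) (h' : W ≤ V) :
    (resHom g h').comp (resHom g h) = resHom g (h'.trans h) := by
  apply AlgHom.ext
  intro x
  change (Y.presheaf.map (homOfLE h).op ≫ Y.presheaf.map (homOfLE h').op).hom x = _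
  rw [← Functor.map_comp]
  rfl

theorem resHom_injective [IsIntegral Y] {V W : Y.Opens} (h : W ≤ V) (hW : (W : Set Y).Nonempty) :
    Function.Injective (resHom g h) :=
  have : Nonempty W := hW.to_subtype
  map_injective_of_isIntegral Y (homOfLE h)

theorem isKaehlerBaseChange_resHom {V : Y.Opens} (hV : IsAffineOpen V) (a : Γ(Y, V)) :
    IsKaehlerBaseChange (resHom g (Y.basicOpen_le a)) :=
  .of_isLocalization _ (Submonoid.powers (M := Sections g V) a) (hV.isLocalization_basicOpen a)

variable [IsIntegral Y] [Smooth g]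

theorem map_resHom_basicOpen_injective {V : Y.Opens} (hV : IsAffineOpen V) (a : Γ(Y, V))
    (ha : (Y.basicOpen a : Set Y).Nonempty) :
    Function.Injective (AlgForm.map (resHom g (Y.basicOpen_le a)) 2) :=
  have := smooth_sections g hV
  AlgForm.map_injective (isKaehlerBaseChange_resHom g hV a) (resHom_injective g _ ha)

/-- Forms on a smooth variety are determined by their restriction to a nonempty open subset. -/
theorem map_resHom_injective {V W : Y.Opens} (hV : IsAffineOpen V) (h : W ≤ V)
    (hW : (W : Set Y).Nonempty) : Function.Injective (AlgForm.map (resHom g h) 2) := by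
  obtain ⟨y, hy⟩ := hW
  obtain ⟨a, haW, hya⟩ := hV.exists_basicOpen_le ⟨y, hy⟩ (h hy)
  have := map_resHom_basicOpen_injective g hV a ⟨y, hya⟩
  intro ω ω' hω
  refine this ?_
  have := congrArg (AlgForm.map (resHom g haW) 2) hω
  rwa [AlgForm.map_map, AlgForm.map_map, resHom_comp] at this

end Sections

/-- The dictionary between primes of a coordinate ring and points of the scheme; open immersions
preserve codimension. -/
theorem exists_mem_coheight_eq {Y : Scheme.{0}} {V : Y.Opens} (hV : IsAffineOpen V)
    (P : Ideal Γ(Y, V)) [P.IsPrime] :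
    ∃ y ∈ V, Order.coheight y = P.height ∧ ∀ a : Γ(Y, V), y ∈ Y.basicOpen a ↔ a ∉ P := by
  let p : Spec Γ(Y, V) := ⟨P, inferInstance⟩
  refine ⟨hV.fromSpec p, ?_, ?_, fun a => ?_⟩
  · have : hV.fromSpec p ∈ Set.range hV.fromSpec := ⟨p, rfl⟩
    rwa [hV.range_fromSpec] at this
  · exact (AlgebraicGeometry.coheight_eq_of_isOpenImmersion hV.fromSpec).trans
      (AlgebraicGeometry.idealHeight_eq_coheight _ p).symm
  · have := congrArg (p ∈ ·) (hV.fromSpec_preimage_basicOpen a)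
    exact this.to_iff

/-- On a normal noetherian variety, functions extend from an open subset containing all points of
codimension at most one. -/
theorem exists_section_of_coheight_le_one {Y : Scheme.{0}} [IsIntegral Y] {U V : Y.Opens}
    (hU : ∀ y, Order.coheight y ≤ 1 → y ∈ U) (hV : IsAffineOpen V) [Nonempty V]
    [IsNoetherianRing Γ(Y, V)] [IsIntegrallyClosed Γ(Y, V)]
    (s : ∀ a : Γ(Y, V), Y.basicOpen a ≤ U → Γ(Y, Y.basicOpen a))
    (hs : ∀ (a c : Γ(Y, V)) (ha : Y.basicOpen a ≤ U) (hc : Y.basicOpen c ≤ U)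
      (h : Y.basicOpen c ≤ Y.basicOpen a), Y.presheaf.map (homOfLE h).op (s a ha) = s c hc) :
    ∃ b : Γ(Y, V), ∀ (a : Γ(Y, V)) (ha : Y.basicOpen a ≤ U),
      Y.presheaf.map (homOfLE (Y.basicOpen_le a)).op b = s a ha := by
  have hη : ∀ {W : Y.Opens} {y : Y}, y ∈ W → genericPoint Y ∈ W := fun {W y} hy =>
    ((genericPoint_spec Y).mem_open_set_iff W.isOpen).mpr (by simpa using ⟨y, hy⟩)
  have hηV : genericPoint Y ∈ V := hη (Classical.arbitrary V).2
  have := functionField_isFractionRing_of_isAffineOpen (X := Y) V hV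
  have hηU : genericPoint Y ∈ U := by
    obtain ⟨y, -, hy, -⟩ := exists_mem_coheight_eq hV (⊥ : Ideal Γ(Y, V))
    exact hη (hU y (by simp [hy]))
  obtain ⟨a₀, ha₀, hηa₀⟩ := hV.exists_basicOpen_le ⟨_, hηU⟩ hηV
  have hmap : ∀ {W W' : Y.Opens} (h : W' ≤ W) (hW : genericPoint Y ∈ W')
      (t : Γ(Y, W)), Y.presheaf.germ W' _ hW (Y.presheaf.map (homOfLE h).op t) =
        Y.presheaf.germ W _ (h hW) t := fun h hW t =>
    TopCat.Presheaf.germ_res_apply Y.presheaf (homOfLE h) _ hW t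
  -- All the given sections define one rational function, as seen on `Y.basicOpen (a * a₀)`.
  have hx : ∀ (a : Γ(Y, V)) (ha : Y.basicOpen a ≤ U) (hηa : genericPoint Y ∈ Y.basicOpen a),
      Y.presheaf.germ _ _ hηa (s a ha) = Y.presheaf.germ _ _ hηa₀ (s a₀ ha₀) := by
    intro a ha hηa
    have h1 : Y.basicOpen (a * a₀) ≤ Y.basicOpen a := by
      rw [Scheme.basicOpen_mul]; exact inf_le_left
    have h2 : Y.basicOpen (a * a₀) ≤ Y.basicOpen a₀ := by
      rw [Scheme.basicOpen_mul]; exact inf_le_right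
    have h3 : genericPoint Y ∈ Y.basicOpen (a * a₀) := by
      rw [Scheme.basicOpen_mul]; exact ⟨hηa, hηa₀⟩
    rw [← hmap h1 h3, ← hmap h2 h3, hs a _ ha (h1.trans ha), hs a₀ _ ha₀ (h1.trans ha)]
  obtain ⟨b, hb⟩ := IsIntegrallyClosed.exists_algebraMap_eq_of_height_le_one (B := Γ(Y, V))
    (K := Y.functionField) (Y.presheaf.germ _ _ hηa₀ (s a₀ ha₀)) (by
      intro P hP hP1
      obtain ⟨y, hyV, hy, hyP⟩ := exists_mem_coheight_eq hV P
      obtain ⟨a, ha, hya⟩ := hV.exists_basicOpen_le ⟨y, hU y (hy.trans_le hP1)⟩ hyV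
      have := hV.isLocalization_basicOpen a
      obtain ⟨n, b, hb⟩ := IsLocalization.Away.surj a (s a ha)
      refine ⟨a ^ n, fun h => (hyP a).mp hya (hP.mem_of_pow_mem n h), b, ?_⟩
      have hηa := hη hya
      rw [← hx a ha hηa]
      have h1 : ∀ t : Γ(Y, V), algebraMap Γ(Y, V) Y.functionField t =
          Y.presheaf.germ _ _ hηa (algebraMap Γ(Y, V) Γ(Y, Y.basicOpen a) t) := fun t =>
        (hmap (Y.basicOpen_le a) hηa t).symm
      rw [h1, h1, ← hb, map_mul, map_pow (algebraMap _ Γ(Y, Y.basicOpen a)), mul_comm])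
  refine ⟨b, fun a ha => ?_⟩
  by_cases hηa : genericPoint Y ∈ Y.basicOpen a
  · refine germ_injective_of_isIntegral Y _ hηa ?_
    rw [hx a ha hηa, ← hb]
    exact hmap _ _ _
  · have : Y.basicOpen a = ⊥ := by
      rw [eq_bot_iff]
      exact fun y hy => (hηa (hη hy)).elim
    have : Subsingleton Γ(Y, Y.basicOpen a) := by
      rw [this]; infer_instance
    exact Subsingleton.elim _ _

end SymplRes

/-! ### Extension of `2`-forms in codimension two -/

namespace SymplRes

section Hartogs

variable {Y : Scheme.{0}} (g : Y ⟶ Spec (.of ℂ))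

theorem subsingleton_sections {W : Y.Opens} (hW : ¬ (W : Set Y).Nonempty) :
    Subsingleton (Sections g W) := by
  have hW : W = ⊥ := Opens.ext (Set.not_nonempty_iff_eq_empty.mp hW)
  change Subsingleton Γ(Y, W)
  rw [hW]
  infer_instance

theorem subsingleton_algForm {W : Y.Opens} (hW : ¬ (W : Set Y).Nonempty) (p : ℕ) :
    Subsingleton (AlgForm (Sections g W) p) :=
  have := subsingleton_sections g hW
  Module.subsingleton (Sections g W) _

theorem exists_basicOpen_le_of_coheight_le_one [IsIntegral Y] {U V : Y.Opens}
    (hU : ∀ y, Order.coheight y ≤ 1 → y ∈ U) (hV : IsAffineOpen V) (hne : (V : Set Y).Nonempty) :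
    ∃ a : Γ(Y, V), Y.basicOpen a ≤ U ∧ (Y.basicOpen a : Set Y).Nonempty := by
  have : Nonempty V := hne.to_subtype
  obtain ⟨y, hyV, hy, -⟩ := exists_mem_coheight_eq hV (⊥ : Ideal Γ(Y, V))
  obtain ⟨a, ha, hya⟩ := hV.exists_basicOpen_le ⟨y, hU y (by simp [hy])⟩ hyV
  exact ⟨a, ha, y, hya⟩

variable [IsIntegral Y] [Smooth g] {U V : Y.Opens}

/-- A dual basis of the projective module of differentials gives coefficient functions on all of
`V`. Each of them extends, and half of their combination with the wedges `e i ∧ e j` is the form. -/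
theorem exists_algForm_of_coheight_le_one (hU : ∀ y, Order.coheight y ≤ 1 → y ∈ U)
    (τ : DiffForm g U 2) (hV : IsAffineOpen V) :
    ∃ ω : AlgForm (Sections g V) 2, ∀ (W : Y.Opens) (hW : IsAffineOpen W) (hWV : W ≤ V)
      (hWU : W ≤ U), AlgForm.map (resHom g hWV) 2 ω = τ.on W hW hWU := by
  by_cases hne : (V : Set Y).Nonempty
  swap
  · refine ⟨0, fun W hW hWV hWU => ?_⟩
    have := subsingleton_algForm g (W := W) (fun h => hne (h.mono hWV)) 2
    exact Subsingleton.elim _ _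
  have : Nonempty V := hne.to_subtype
  have := smooth_sections g hV
  have : IsDomain (Sections g V) := isDomain_sections g V
  have : IsNoetherianRing (Sections g V) := Algebra.FiniteType.isNoetherianRing ℂ _
  have : IsIntegrallyClosed (Sections g V) := Algebra.Smooth.isIntegrallyClosed ℂ
  obtain ⟨n, e, f, hef⟩ := exists_dual_basis (A := Sections g V)
  have hbc := isKaehlerBaseChange_resHom g hV
  choose f' hf' using fun (a : Γ(Y, V)) i => (hbc a).exists_extend (f i)
  let ev (a : Γ(Y, V)) (ha : Y.basicOpen a ≤ U) (i j : Fin n) : Sections g (Y.basicOpen a) :=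
    AlgForm.eval ![f' a i, f' a j] (τ.on _ (hV.basicOpen a) ha)
  have hb : ∀ i j, ∃ b : Sections g V, ∀ (a : Γ(Y, V)) (ha : Y.basicOpen a ≤ U),
      resHom g (Y.basicOpen_le a) b = ev a ha i j := by
    intro i j
    have : IsNoetherianRing Γ(Y, V) := ‹IsNoetherianRing (Sections g V)›
    have : IsIntegrallyClosed Γ(Y, V) := ‹IsIntegrallyClosed (Sections g V)›
    refine exists_section_of_coheight_le_one hU hV (fun a ha => ev a ha i j) ?_
    intro a c ha hc h
    -- The extended functionals agree on smaller basic opens because they agree on the differentials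
    -- coming from `V`, which generate.
    have hres : ∀ i y, f' c i (kaehlerMap (resHom g h) y) = resHom g h (f' a i y) := by
      intro i y
      have hy : y ∈ Submodule.span (Sections g (Y.basicOpen a))
          (Set.range (kaehlerMap (resHom g (Y.basicOpen_le a)))) := by
        rw [(hbc a).span_eq_top]; trivial
      induction hy using Submodule.span_induction with
      | mem y hy =>
        obtain ⟨x, rfl⟩ := hy
        rw [kaehlerMap_comp, resHom_comp, hf', hf', ← AlgHom.comp_apply, resHom_comp]
      | zero => simp
      | add x y _ _ hx hy => simp only [map_add, hx, hy]
      | smul r x _ hx => simp only [kaehlerMap_smul, map_smul, smul_eq_mul, map_mul, hx]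
    refine (AlgForm.eval_two_map (resHom g h) (resHom g h).toRingHom (fun _ => rfl)
      (hres i) (hres j) (τ.on _ (hV.basicOpen a) ha)).symm.trans ?_
    rw [τ.res]
  choose b hb using hb
  obtain ⟨r, hr⟩ := (isUnit_two (A := Sections g V)).exists_left_inv
  let ω : AlgForm (Sections g V) 2 := r • ∑ i, ∑ j, b i j • wedge (e i) (e j)
  have hω : (2 : Sections g V) • ω = ∑ i, ∑ j, b i j • wedge (e i) (e j) := by
    rw [smul_smul, mul_comm, hr, one_smul]
  have key : ∀ (a : Γ(Y, V)) (ha : Y.basicOpen a ≤ U),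
      AlgForm.map (resHom g (Y.basicOpen_le a)) 2 ω = τ.on _ (hV.basicOpen a) ha := by
    intro a ha
    have h2 : resHom g (Y.basicOpen_le a) 2 = 2 := map_ofNat _ 2
    rw [← (isUnit_two (A := Sections g (Y.basicOpen a))).smul_left_cancel,
      ← AlgForm.sum_eval_smul_wedge _ _ ((hbc a).dual_basis hef (hf' a)) (τ.on _ _ _), ← h2,
      ← AlgForm.map_smul, hω]
    simp only [map_sum, AlgForm.map_smul, AlgForm.map_wedge, hb _ _ a ha, ev]
  refine ⟨ω, fun W hW hWV hWU => ?_⟩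
  by_cases hWne : (W : Set Y).Nonempty
  swap
  · have := subsingleton_algForm g hWne 2
    exact Subsingleton.elim _ _
  obtain ⟨y, hy⟩ := hWne
  obtain ⟨a, haW, hya⟩ := hV.exists_basicOpen_le ⟨y, hy⟩ (hWV hy)
  refine map_resHom_injective g hW haW ⟨y, hya⟩ ?_
  rw [AlgForm.map_map, resHom_comp, key a (haW.trans hWU), τ.res]

/-- On a smooth variety, `2`-forms extend from an open subset containing all points of codimension
at most one. -/
theorem exists_diffForm_of_coheight_le_one (hU : ∀ y, Order.coheight y ≤ 1 → y ∈ U)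
    (τ : DiffForm g U 2) :
    ∃ τ' : DiffForm g ⊤ 2, ∀ (W : Y.Opens) (hW : IsAffineOpen W) (hWU : W ≤ U),
      τ'.on W hW le_top = τ.on W hW hWU := by
  choose ω hω using fun (V : Y.Opens) (hV : IsAffineOpen V) =>
    exists_algForm_of_coheight_le_one g hU τ hV
  refine ⟨⟨fun V hV _ => ω V hV, ?_⟩, ?_⟩
  · intro V W hV hW _ hWV
    by_cases hWne : (W : Set Y).Nonempty
    swap
    · have := subsingleton_algForm g hWne 2
      exact Subsingleton.elim _ _
    -- Compatibility may be tested on a nonempty basic open inside `U`, where both sides are `τ`.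
    obtain ⟨a, haU, ha⟩ := exists_basicOpen_le_of_coheight_le_one hU hW hWne
    refine map_resHom_injective g hW (Y.basicOpen_le a) ha ?_
    rw [AlgForm.map_map, resHom_comp, hω V hV _ (hW.basicOpen a) _ haU,
      hω W hW _ (hW.basicOpen a) _ haU]
  · intro W hW hWU
    by_cases hWne : (W : Set Y).Nonempty
    swap
    · have := subsingleton_algForm g hWne 2
      exact Subsingleton.elim _ _
    refine map_resHom_injective g hW le_rfl hWne ?_
    rw [hω W hW W hW le_rfl hWU, τ.res]

end Hartogs

end SymplRes

-- Symplecticity of the extended form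

-- Freeness is transported between two models of the same localization, along an isomorphism
-- semilinear over the ring isomorphism.
attribute [local instance] RingHomInvPair.of_ringEquiv in
theorem IsLocalizedModule.free_of_free {R M : Type} [CommRing R] [AddCommGroup M] [Module R M]
    (S : Submonoid R) (R' M' : Type) [CommRing R'] [Algebra R R'] [IsLocalization S R']
    [AddCommGroup M'] [Module R M'] (f : M →ₗ[R] M') [IsLocalizedModule S f] [Module R' M']
    [IsScalarTower R R' M'] [Module.Free (Localization S) (LocalizedModule S M)] :
    Module.Free R' M' := by
  set e := (IsLocalization.algEquiv S (Localization S) R').toRingEquiv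
  refine (Module.Free.iff_of_equiv (R := Localization S) (M := LocalizedModule S M)
    (σ := (e : Localization S →+* R')) ?_).mp inferInstance
  refine { __ := IsLocalizedModule.iso S f, map_smul' := ?_ }
  intro r x
  obtain ⟨r, s, rfl⟩ := IsLocalization.exists_mk'_eq S r
  apply ((Module.End.isUnit_iff _).mp (IsLocalizedModule.map_units f s)).1
  simp [e, ← map_smul, ← smul_assoc]

namespace SymplRes

/-- A finite projective module is free at the prime `ker φ`, and freeness spreads to a basic
neighbourhood. Quantifying over all models `B` allows sections over a basic open to be used
directly. -/
theorem exists_free_kaehlerDifferential {A : Type} [CommRing A] [Algebra ℂ A]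
    [Algebra.Smooth ℂ A] {K : Type} [Field K] (φ : A →+* K) :
    ∃ r, φ r ≠ 0 ∧ ∀ (B : Type) [CommRing B] [Algebra ℂ B] [Algebra A B] [IsScalarTower ℂ A B]
      [IsLocalization.Away r B], Module.Free B Ω[B⁄ℂ] := by
  let P := RingHom.ker φ
  have : P.IsPrime := RingHom.ker_isPrime φ
  have : Module.FinitePresentation A Ω[A⁄ℂ] := Module.finitePresentation_of_projective _ _
  have : Module.Free (Localization P.primeCompl) (LocalizedModule P.primeCompl Ω[A⁄ℂ]) :=
    Module.free_of_flat_of_isLocalRing (R := Localization.AtPrime P)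
  have : Nontrivial (Localization P.primeCompl) :=
    inferInstanceAs (Nontrivial (Localization.AtPrime P))
  obtain ⟨r, hr, _, -⟩ := Module.FinitePresentation.exists_free_localizedModule_powers
    P.primeCompl (LocalizedModule.mkLinearMap P.primeCompl Ω[A⁄ℂ]) (Localization P.primeCompl)
  exact ⟨r, hr, fun B _ _ _ _ _ => IsLocalizedModule.free_of_free (.powers r) B _
    (KaehlerDifferential.map ℂ ℂ A B)⟩

variable {Y : Scheme.{0}} (g : Y ⟶ Spec (.of ℂ))

theorem evaluation_resHom {V W : Y.Opens} (h : W ≤ V) {y : Y} (hy : y ∈ W) (x : Sections g V) :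
    (Y.evaluation W y hy).hom (resHom g h x) = (Y.evaluation V y (h hy)).hom x :=
  congrArg (Y.residue y).hom (TopCat.Presheaf.germ_res_apply Y.presheaf (homOfLE h) y hy x)

theorem exists_free_kaehlerDifferential_basicOpen [Smooth g] {V : Y.Opens} (hV : IsAffineOpen V)
    {y : Y} (hy : y ∈ V) : ∃ a : Γ(Y, V), y ∈ Y.basicOpen a ∧
      Module.Free (Sections g (Y.basicOpen a)) Ω[Sections g (Y.basicOpen a)⁄ℂ] := by
  have := smooth_sections g hV
  obtain ⟨r, hr, h⟩ := exists_free_kaehlerDifferential (A := Sections g V)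
    (Y.evaluation V y hy).hom
  refine ⟨r, (Y.evaluation_ne_zero_iff_mem_basicOpen y hy r).mp hr, ?_⟩
  let : Algebra (Sections g V) (Sections g (Y.basicOpen (r : Γ(Y, V)))) :=
    (resHom g (Y.basicOpen_le (r : Γ(Y, V)))).toRingHom.toAlgebra
  have : IsScalarTower ℂ (Sections g V) (Sections g (Y.basicOpen (r : Γ(Y, V)))) :=
    IsScalarTower.of_algebraMap_eq' (resHom g (Y.basicOpen_le _)).comp_algebraMap.symm
  have : IsLocalization.Away r (Sections g (Y.basicOpen (r : Γ(Y, V)))) :=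
    hV.isLocalization_basicOpen r
  exact h _

theorem nondegenerateAt_of_coheight_le_one [IsIntegral Y] [Smooth g] {U : Y.Opens}
    (hU : ∀ y, Order.coheight y ≤ 1 → y ∈ U) {τ : DiffForm g ⊤ 2} {τ₀ : DiffForm g U 2}
    (hτ₀ : τ₀.IsSymplectic) (hτ : ∀ (W : Y.Opens) (hW : IsAffineOpen W) (hWU : W ≤ U),
      τ.on W hW le_top = τ₀.on W hW hWU) {D : Y.Opens} (hD : IsAffineOpen D)
    [Module.Free (Sections g D) Ω[Sections g D⁄ℂ]] {y : Y} (hy : y ∈ D) :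
    AlgForm.NondegenerateAt (A := Sections g D) (Y.evaluation D y hy).hom (τ.on D hD le_top) := by
  have : Nonempty D := ⟨y, hy⟩
  have := smooth_sections g hD
  have : IsDomain (Sections g D) := isDomain_sections g D
  have : IsNoetherianRing (Sections g D) := Algebra.FiniteType.isNoetherianRing ℂ _
  have : IsIntegrallyClosed (Sections g D) := Algebra.Smooth.isIntegrallyClosed ℂ
  let b := Module.finBasis (Sections g D) Ω[Sections g D⁄ℂ]
  refine (AlgForm.nondegenerateAt_iff b _ (Y.evaluation D y hy).hom).mpr ?_
  -- A prime of height at most one is a point of `U`, where the form is `τ₀` and so has nonzero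
  -- determinant. The determinant is therefore a unit, and nonzero at `y`.
  refine ((IsNoetherianRing.isUnit_of_height_le_one _ fun P hP hP1 => ?_).map _).ne_zero
  obtain ⟨z, hzD, hz, hzP⟩ := @exists_mem_coheight_eq Y D hD P hP
  obtain ⟨c, hcU, hzc⟩ := hD.exists_basicOpen_le ⟨z, hU z (hz.trans_le hP1)⟩ hzD
  refine (hzP _).mp ((Y.evaluation_ne_zero_iff_mem_basicOpen z hzD _).mp ?_)
  refine (AlgForm.nondegenerateAt_iff b _ (Y.evaluation D z hzD).hom).mp ?_
  refine AlgForm.NondegenerateAt.of_map (isKaehlerBaseChange_resHom g hD c)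
    (evaluation_resHom g _ hzc) ?_
  rw [τ.res _ _ _ (hD.basicOpen c), hτ _ _ hcU]
  exact hτ₀.nondegenerate _ _ _ _ _

/-- Extensions of symplectic forms from an open subset containing all points of codimension at most
one are symplectic. -/
theorem isSymplectic_of_coheight_le_one [IsIntegral Y] [Smooth g] {U : Y.Opens}
    (hU : ∀ y, Order.coheight y ≤ 1 → y ∈ U) {τ : DiffForm g ⊤ 2} {τ₀ : DiffForm g U 2}
    (hτ₀ : τ₀.IsSymplectic) (hτ : ∀ (W : Y.Opens) (hW : IsAffineOpen W) (hWU : W ≤ U),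
      τ.on W hW le_top = τ₀.on W hW hWU) : τ.IsSymplectic := by
  refine ⟨fun V hV _ => ?_, fun V hV _ y hy => ?_⟩
  · by_cases hne : (V : Set Y).Nonempty
    · obtain ⟨a, haU, ha⟩ := exists_basicOpen_le_of_coheight_le_one hU hV hne
      refine AlgForm.IsClosed.of_map (isKaehlerBaseChange_resHom g hV a)
        (resHom_injective g _ ha) ?_
      rw [τ.res _ _ _ (hV.basicOpen a), hτ _ _ haU]
      exact hτ₀.closed _ _ _
    · have := subsingleton_sections g hne
      exact fun _ _ _ => Subsingleton.elim _ _
  · obtain ⟨a, hya, hfree⟩ := exists_free_kaehlerDifferential_basicOpen g hV hy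
    refine AlgForm.NondegenerateAt.of_map (isKaehlerBaseChange_resHom g hV a)
      (evaluation_resHom g _ hya) ?_
    rw [τ.res _ _ _ (hV.basicOpen a) _ (Y.basicOpen_le a)]
    exact nondegenerateAt_of_coheight_le_one g hU hτ₀ hτ (hV.basicOpen a) hya

end SymplRes

/-! ### Agreement with the pullback of `σ` -/

namespace SymplRes

variable {X Y : Scheme.{0}} (f : X ⟶ Spec (.of ℂ)) (π : Y ⟶ X)

theorem resHom_comp_pullHom {V V' : X.Opens} {W W' : Y.Opens} (hV : V' ≤ V) (hW : W' ≤ W)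
    (h : W ≤ π ⁻¹ᵁ V) (h' : W' ≤ π ⁻¹ᵁ V') :
    (resHom (π ≫ f) hW).comp (pullHom f π h) = (pullHom f π h').comp (resHom f hV) := by
  apply AlgHom.ext
  intro x
  change (π.appLE V W h ≫ Y.presheaf.map (homOfLE hW).op).hom x =
    (X.presheaf.map (homOfLE hV).op ≫ π.appLE V' W' h').hom x
  rw [Scheme.Hom.appLE_map, Scheme.Hom.map_appLE]

theorem isExtension_top_of_coheight_le_one [IsIntegral Y] [Smooth (π ≫ f)] {U : X.Opens}
    (hU : ∀ y, Order.coheight y ≤ 1 → y ∈ π ⁻¹ᵁ U) {σ : DiffForm f (regularLocus X) 2}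
    {τ : DiffForm (π ≫ f) ⊤ 2} {τ₀ : DiffForm (π ≫ f) (π ⁻¹ᵁ U) 2} (hτ₀ : IsExtension σ U τ₀)
    (hτ : ∀ (W : Y.Opens) (hW : IsAffineOpen W) (hWU : W ≤ π ⁻¹ᵁ U),
      τ.on W hW le_top = τ₀.on W hW hWU) : IsExtension (π := π) σ ⊤ τ := by
  intro V hV hVr _ W hW hWV
  by_cases hne : (W : Set Y).Nonempty
  swap
  · have := subsingleton_algForm (π ≫ f) hne 2
    exact Subsingleton.elim _ _
  obtain ⟨a, haU, w, hwa⟩ := exists_basicOpen_le_of_coheight_le_one hU hW hne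
  have hwW : w ∈ W := Y.basicOpen_le a hwa
  -- The hypothesis on `τ₀` concerns affine opens inside `U`, so both `V` and `W` are shrunk around
  -- `w`; the nonempty `Y.basicOpen d` suffices for the comparison.
  obtain ⟨c, hcU, hwc⟩ := hV.exists_basicOpen_le ⟨π w, haU hwa⟩ (hWV hwW)
  obtain ⟨d, hdc, hwd⟩ := hW.exists_basicOpen_le (V := π ⁻¹ᵁ X.basicOpen c) ⟨w, hwc⟩ hwW
  refine map_resHom_injective (π ≫ f) hW (Y.basicOpen_le d) ⟨w, hwd⟩ ?_
  refine (τ.res _ _ _ (hW.basicOpen d) _ _).trans ?_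
  rw [hτ _ _ (hdc.trans (π.preimage_mono hcU)),
    hτ₀ _ (hV.basicOpen c) ((X.basicOpen_le c).trans hVr) hcU _ _ hdc, AlgForm.map_map,
    resHom_comp_pullHom f π (X.basicOpen_le c) _ _ hdc, ← AlgForm.map_map, σ.res]

theorem extendsSymplecticallyOver_top_of_coheight_le_one [IsIntegral Y] [Smooth (π ≫ f)]
    {U : X.Opens} (hU : ∀ y, Order.coheight y ≤ 1 → y ∈ π ⁻¹ᵁ U)
    {σ : DiffForm f (regularLocus X) 2} (h : ExtendsSymplecticallyOver f π σ U) :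
    ExtendsSymplecticallyOver f π σ ⊤ := by
  obtain ⟨τ₀, hs, he⟩ := h
  obtain ⟨τ, hτ⟩ := exists_diffForm_of_coheight_le_one (π ≫ f) hU τ₀
  exact ⟨τ, isSymplectic_of_coheight_le_one _ hU hs hτ,
    isExtension_top_of_coheight_le_one f π hU he hτ⟩

end SymplRes

/-! ### Codimension-one points of a semismall resolution -/

namespace SymplRes

variable {X Y : Scheme.{0}} {f : X ⟶ Spec (.of ℂ)} {π : Y ⟶ X}

theorem height_primeIdealOf {V : X.Opens} (hV : IsAffineOpen V) (x : V) :
    (hV.primeIdealOf x).asIdeal.height = Order.coheight x.1 := by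
  conv_rhs => rw [← hV.fromSpec_primeIdealOf x]
  exact (AlgebraicGeometry.idealHeight_eq_coheight _ _).trans
    (AlgebraicGeometry.coheight_eq_of_isOpenImmersion hV.fromSpec).symm

/-- The affine fibre is a subspace of the scheme-theoretic fibre, and dimension is monotone for
subspaces. -/
theorem topologicalKrullDim_comap_preimage_le {V : X.Opens} (hV : IsAffineOpen V) {W : Y.Opens}
    (hW : IsAffineOpen W) (h : W ≤ π ⁻¹ᵁ V) (p : PrimeSpectrum Γ(X, V)) :
    topologicalKrullDim (PrimeSpectrum.comap (π.appLE V W h).hom ⁻¹' {p}) ≤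
      topologicalKrullDim (π.fiber (hV.fromSpec p)) := by
  have hc : ∀ z : Spec Γ(Y, W), π (hW.fromSpec z) =
      hV.fromSpec (PrimeSpectrum.comap (π.appLE V W h).hom z) := fun z => by
    have := congrArg (fun φ : Spec Γ(Y, W) ⟶ X => φ z) (hV.SpecMap_appLE_fromSpec π hW h)
    exact this.symm
  let φ : PrimeSpectrum.comap (π.appLE V W h).hom ⁻¹' {p} → π ⁻¹' {hV.fromSpec p} :=
    fun z => ⟨hW.fromSpec z.1, (hc z.1).trans (congrArg hV.fromSpec z.2)⟩
  have hφ : Topology.IsInducing φ :=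
    (Topology.IsInducing.subtypeVal.of_comp_iff (f := φ)).mp
      (hW.fromSpec.isOpenEmbedding.isInducing.comp Topology.IsInducing.subtypeVal)
  exact ((π.fiberHomeo (hV.fromSpec p)).symm.isInducing.comp hφ).topologicalKrullDim_le

/-- Dominance of `π`: it is an isomorphism over a dense open set, which meets `V`. -/
theorem IsResolution.genericPoint_mem_preimage [IsIntegral X] [IsIntegral Y]
    (hπ : IsResolution f π) {V : X.Opens} (hV : (V : Set X).Nonempty) :
    genericPoint Y ∈ π ⁻¹ᵁ V := by
  obtain ⟨U, hU, -, hiso⟩ := hπ.birational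
  obtain ⟨x, hxV, hxU⟩ := hU.inter_open_nonempty V V.isOpen hV
  obtain ⟨y, hy⟩ := (π ∣_ U).homeomorph.surjective ⟨x, hxU⟩
  have hyx : π y.1 = x := by
    have := morphismRestrict_base_coe π U y
    rw [← this]
    exact congrArg Subtype.val hy
  refine ((genericPoint_spec Y).mem_open_set_iff (π ⁻¹ᵁ V).isOpen).mpr
    ⟨y.1, Set.mem_univ _, ?_⟩
  change π y.1 ∈ V
  rwa [hyx]

/-- A nonzero function has a nonempty nonvanishing locus, whose preimage contains the generic point
of `Y`; hence its pullback is nonzero. -/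
theorem IsResolution.appLE_injective [IsIntegral X] [IsIntegral Y] (hπ : IsResolution f π)
    {V : X.Opens} {W : Y.Opens} (hW : (W : Set Y).Nonempty) (h : W ≤ π ⁻¹ᵁ V) :
    Function.Injective (π.appLE V W h).hom := by
  rw [injective_iff_map_eq_zero]
  intro s hs
  by_contra hs0
  have h1 : (X.basicOpen s : Set X).Nonempty := by
    by_contra h1
    exact hs0 ((basicOpen_eq_bot_iff s).mp (Opens.ext (Set.not_nonempty_iff_eq_empty.mp h1)))
  have h2 : genericPoint Y ∈ Y.basicOpen (π.appLE V W h s) := by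
    rw [Scheme.basicOpen_appLE]
    exact ⟨((genericPoint_spec Y).mem_open_set_iff W.isOpen).mpr (by simpa using hW),
      hπ.genericPoint_mem_preimage h1⟩
  rw [hs, Scheme.basicOpen_zero] at h2
  exact h2

theorem exists_height_comap_le_topologicalKrullDim_fiber_add_one {A B : Type} [CommRing A]
    [CommRing B] [IsDomain A] [IsDomain B] [Algebra ℂ A] [Algebra ℂ B] [Algebra.FiniteType ℂ A]
    [Algebra.FiniteType ℂ B] (φ : A →ₐ[ℂ] B) (hφ : Function.Injective φ) (q : PrimeSpectrum B)
    (hq : q.asIdeal.height ≤ 1) :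
    ∃ d : ℕ, (d : WithBot ℕ∞) ≤ topologicalKrullDim
        (PrimeSpectrum.comap φ.toRingHom ⁻¹' {PrimeSpectrum.comap φ.toRingHom q}) ∧
      (PrimeSpectrum.comap φ.toRingHom q).asIdeal.height ≤ d + 1 := by
  let : Algebra A B := φ.toRingHom.toAlgebra
  have : IsScalarTower ℂ A B := IsScalarTower.of_algebraMap_eq' φ.comp_algebraMap.symm
  have : FaithfulSMul A B := (faithfulSMul_iff_algebraMap_injective A B).mpr hφ
  exact PrimeSpectrum.exists_height_le_topologicalKrullDim_fiber_add_one ℂ _ q hq rfl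

/-- The points of codimension at most one of a resolution lie over points whose codimension exceeds
the dimension of the fibre by at most one. -/
theorem IsResolution.exists_coheight_le_topologicalKrullDim_fiber_add_one (hX : IsVariety f)
    (hπ : IsResolution f π) {y : Y} (hy : Order.coheight y ≤ 1) :
    ∃ d : ℕ, (d : WithBot ℕ∞) ≤ topologicalKrullDim (π.fiber (π y)) ∧
      Order.coheight (π y) ≤ d + 1 := by
  have := hX.isIntegral
  have := hX.locallyOfFiniteType
  have := hπ.isVariety.isIntegral
  have := hπ.isVariety.locallyOfFiniteType
  obtain ⟨V, hV, hxV, -⟩ := exists_isAffineOpen_mem_and_subset (U := ⊤) (x := π y) trivial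
  obtain ⟨W, hW, hyW, hWV⟩ := exists_isAffineOpen_mem_and_subset (U := π ⁻¹ᵁ V) (x := y) hxV
  have hWV : W ≤ π ⁻¹ᵁ V := hWV
  have : Nonempty V := ⟨_, hxV⟩
  have : Nonempty W := ⟨_, hyW⟩
  have : IsDomain (Sections f V) := isDomain_sections f V
  have : IsDomain (Sections (π ≫ f) W) := isDomain_sections (π ≫ f) W
  have := finiteType_sections f hV
  have := finiteType_sections (π ≫ f) hW
  obtain ⟨d, hd, hdp⟩ := exists_height_comap_le_topologicalKrullDim_fiber_add_one
    (pullHom f π hWV) (hπ.appLE_injective ⟨y, hyW⟩ hWV) (hW.primeIdealOf ⟨y, hyW⟩)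
    ((height_primeIdealOf hW ⟨y, hyW⟩).trans_le hy)
  have hp := IsAffineOpen.comap_primeIdealOf_appLE V hV W hW hWV hyW
  refine ⟨d, hd.trans ?_, ?_⟩
  · have h := topologicalKrullDim_comap_preimage_le hV hW hWV
      (PrimeSpectrum.comap (π.appLE V W hWV).hom (hW.primeIdealOf ⟨y, hyW⟩))
    have hπy : hV.fromSpec (PrimeSpectrum.comap (π.appLE V W hWV).hom
        (hW.primeIdealOf ⟨y, hyW⟩)) = π y := by
      rw [hp, hV.fromSpec_primeIdealOf]
    rwa [hπy] at h
  · rw [← height_primeIdealOf hV ⟨π y, hxV⟩, ← hp]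
    exact hdp

theorem mem_preimage_compl_of_coheight_le_one (hX : IsVariety f) (hπ : IsResolution f π)
    (hsemi : IsSemismall π) {F : Closeds X} (hF : 4 ≤ codim (F : Set X)) {y : Y}
    (hy : Order.coheight y ≤ 1) : y ∈ π ⁻¹ᵁ F.compl := by
  by_contra hyF
  have hyF : π y ∈ (F : Set X) := not_not.mp hyF
  obtain ⟨d, hd, hdx⟩ := hπ.exists_coheight_le_topologicalKrullDim_fiber_add_one hX hy
  have h4 : 4 ≤ Order.coheight (π y) := hF.trans (iInf₂_le (π y) hyF)
  have h2 : (2 * d : ℕ∞) ≤ Order.coheight (π y) := (hsemi d).trans (iInf₂_le (π y) hd)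
  have h5 := h2.trans hdx
  have h6 := h4.trans hdx
  norm_cast at h5 h6
  -- Semismallness forces `2d ≤ d + 1`, so `d ≤ 1`, whereas the codimension of `F` forces `4 ≤ d +
  -- 1`.
  omega

end SymplRes

theorem mainTheorem11 {X Y : Scheme.{0}} (f : X ⟶ Spec (.of ℂ)) (hX : SymplRes.IsVariety f)
    (σ : SymplRes.DiffForm f (SymplRes.regularLocus X) 2) (hσ : σ.IsSymplectic)
    (π : Y ⟶ X) (hπ : SymplRes.IsResolution f π) (hsemi : SymplRes.IsSemismall π)
    (F : Closeds X) (hF : 4 ≤ SymplRes.codim (F : Set X))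
    (hres : SymplRes.RestrictsToSymplecticResolution f π σ F.compl) :
    SymplRes.IsSymplecticResolution f π σ := by
  have := hπ.isVariety.isIntegral
  have := hπ.smooth
  exact ⟨hπ, SymplRes.extendsSymplecticallyOver_top_of_coheight_le_one f π
    (fun _ hy => SymplRes.mem_preimage_compl_of_coheight_le_one hX hπ hsemi hF hy) hres.2⟩
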